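/- **Theorem 4.3.1 (number of photons in the leaking cavity).** Let $\epsilon,E,\lambda\in\mathbb R$ and $\sigma,\tau>0$. The cavity is one boson mode with Fock space $\mathcal H_C=\ell^2(\mathbb N)$ and annihilation and creation operators $b,b^*$. It is pumped by two-level atoms, with number operators $a_k^*a_k$ ($k=1,2,\dots$), which pass one after another: the $k$-th atom is in the cavity for $(k-1)\tau\le t<k\tau$. The Hamiltonian is $$H(t)=\epsilon\, b^*b+\sum_{k}E\,a_k^*a_k+\sum_{k}\chi_{[(k-1)\tau,k\tau)}(t)\,\lambda\,(b^*+b)\otimes a_k^*a_k .$$ Initially the system is in a product state $\rho_C\otimes\eta\otimes\eta\otimes\cdots$. Here $\eta$ is a density matrix on $\mathbb C^2$ that commutes with $a^*a$, and $p=\mathrm{Tr}(a^*a\,\eta)$. The density matrix $\rho_C$ on $\mathcal H_C$ is gauge invariant, that is $e^{i\alpha b^*b}\rho_C e^{-i\alpha b^*b}=\rho_C$ for all $\alpha\in\mathbb R$, and has a finite photon number $N_\sigma(0)=\mathrm{Tr}(b^*b\,\rho_C)<\infty$. Let $\rho_S(t)$ be the state of the cavity and the first $M$ atoms for $0\le t\le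 M\tau$. It is a density-matrix valued solution of the Cauchy problem $$\frac{d}{dt}\rho_S=-i[H(t),\rho_S]+\sigma\, b\rho_S b^*-\frac{\sigma}{2}\{b^*b,\rho_S\},\qquad \rho_S(0)=\rho_C\otimes\eta^{\otimes M},$$ where the equation is understood for the matrix elements between finite-particle vectors, which are continuous in $t$ and have the corresponding right derivative. Put $N_\sigma(t)=\mathrm{Tr}(b^*b\,\rho_{C,\sigma}(t))$, where $\rho_{C,\sigma}(t)$ is the partial trace of $\rho_S(t)$ over the atoms, and $\mu=\frac{\sigma}{2}+i\epsilon$. Then for all $n\le M$ the photon number $N_\sigma(n\tau)$ is finite and $$\begin{aligned}N_\sigma(n\tau)={}&e^{-n\sigma\tau}N_\sigma(0) +p\,\frac{\lambda^2}{|\mu|^2}\bigl(1+e^{-\sigma\tau}-2e^{-\sigma\tau/2}\cos\epsilon\tau\bigr)\frac{1-e^{-n\sigma\tau}}{1-e^{-\sigma\tau}}\\ &-p^2\,\frac{2\lambda^2}{|\mu|^2}\bigl(1-e^{-\sigma\tau/2}\cos\epsilon\tau\bigr)\frac{1-e^{-n\sigma\tau}}{1-e^{-\sigma\tau}} +p^2\,\frac{2\lambda^2}{|\mu|^2}\bigl(1-e^{-n\sigma\tau/2}\cos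 n\epsilon\tau\bigr).\end{aligned}$$ Moreover, as $n\to\infty$, $N_\sigma(n\tau)$ converges to $$N_\sigma^\infty=\frac{4\lambda^2}{4\epsilon^2+\sigma^2}\,\frac{p}{1-e^{-\sigma\tau}}\Bigl\{1+e^{-\sigma\tau}(1-2p)-2e^{-\sigma\tau/2}(1-p)\cos\epsilon\tau\Bigr\}.$$ -/

import Mathlib

open scoped ENNReal Matrix ComplexOrder InnerProductSpace
open Filter Topology

noncomputable section

namespace LeakyCavity

/-! ### The cavity: one boson mode -/

/-- The Hilbert space of the cavity: the bosonic Fock space over `ℂ`, that is `ℓ²(ℕ, ℂ)`. The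
`m`-th unit vector is the state with exactly `m` photons. -/
abbrev Cavity : Type := lp (fun _ : ℕ => ℂ) 2

/-- The vector of `Cavity` with exactly `m` photons. -/
def fock (m : ℕ) : Cavity := lp.single 2 m (1 : ℂ)

/-- Finite-particle vectors of the cavity: the common dense domain on which the unbounded
operators are defined. -/
abbrev FinCavity : Type := ℕ →₀ ℂ

/-- The inclusion of the finite-particle vectors into the cavity space. -/
def FinCavity.toCavity : FinCavity →ₗ[ℂ] Cavity := Finsupp.linearCombination ℂ fock

/-- The annihilation operator `b`, with `b |m⟩ = √m |m - 1⟩` (and `b |0⟩ = 0`). -/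
def annih : FinCavity →ₗ[ℂ] FinCavity :=
  Finsupp.linearCombination ℂ fun m => Finsupp.single (m - 1) ((Real.sqrt m : ℝ) : ℂ)

/-- The creation operator `b*`, with `b* |m⟩ = √(m + 1) |m + 1⟩`. -/
def creat : FinCavity →ₗ[ℂ] FinCavity :=
  Finsupp.linearCombination ℂ fun m => Finsupp.single (m + 1) ((Real.sqrt (m + 1) : ℝ) : ℂ)

/-- The photon number operator `b* b`. -/
def photonOp : FinCavity →ₗ[ℂ] FinCavity := creat ∘ₗ annih

/-- A normal state (density matrix) of the cavity: a positive operator of trace one. -/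
def IsCavityState (ρ : Cavity →L[ℂ] Cavity) : Prop :=
  ρ.IsPositive ∧ HasSum (fun m : ℕ => ⟪fock m, ρ (fock m)⟫_ℂ) 1

theorem norm_phase (α : ℝ) (m : ℕ) : ‖Complex.exp (((α * m : ℝ) : ℂ) * Complex.I)‖ = 1 :=
  Complex.norm_exp_ofReal_mul_I _

theorem memℓp_phase (α : ℝ) (x : Cavity) :
    Memℓp (fun m : ℕ => Complex.exp (((α * m : ℝ) : ℂ) * Complex.I) * x m) 2 := by
  refine (lp.memℓp x).mono' fun m => ?_
  rw [norm_mul, norm_phase, one_mul]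

/-- The unitary operator `exp (i α b* b)`, which multiplies the `m`-photon component by
`exp (i α m)`. -/
def phase (α : ℝ) : Cavity →L[ℂ] Cavity :=
  LinearMap.mkContinuous
    { toFun := fun x => ⟨_, memℓp_phase α x⟩
      map_add' := fun x y => Subtype.ext <| funext fun m => mul_add _ (x m) (y m)
      map_smul' := fun c x => Subtype.ext <| funext fun m => mul_left_comm _ c (x m) }
    1 (fun x => by
      rw [one_mul]
      refine lp.norm_mono (by norm_num) fun m => ?_
      change ‖Complex.exp (((α * m : ℝ) : ℂ) * Complex.I) * x m‖ ≤ ‖x m‖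
      rw [norm_mul, norm_phase, one_mul])

/-- Gauge invariance of a state of the cavity: `exp (i α b* b) ρ exp (- i α b* b) = ρ` for all
real `α`. -/
def IsGaugeInvariant (ρ : Cavity →L[ℂ] Cavity) : Prop :=
  ∀ α : ℝ, phase α ∘L ρ ∘L phase (-α) = ρ

/-- The diagonal matrix elements `⟨m| b* b ρ |m⟩` in the photon number basis. -/
def photonTerm (ρ : Cavity →L[ℂ] Cavity) (m : ℕ) : ℝ :=
  (⟪(photonOp (Finsupp.single m 1)).toCavity, ρ (fock m)⟫_ℂ).re

/-- The state `ρ` has a finite mean photon number, `Tr (b* b ρ) < ∞`. -/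
def FinitePhotonNumber (ρ : Cavity →L[ℂ] Cavity) : Prop := Summable (photonTerm ρ)

/-- The mean photon number `Tr (b* b ρ)`. -/
def photonNumber (ρ : Cavity →L[ℂ] Cavity) : ℝ := ∑' m, photonTerm ρ m

/-! ### The beam: two-level atoms -/

/-- The one-point fermion annihilation operator `a` of a two-level atom; the basis vector `0` of
`ℂ²` is the ground state and the basis vector `1` is the excited state. -/
def atomAnnih : Matrix (Fin 2) (Fin 2) ℂ := !![0, 1; 0, 0]

/-- The atomic number operator `a* a`. -/
def atomNumber : Matrix (Fin 2) (Fin 2) ℂ := atomAnnihᴴ * atomAnnih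

/-- A gauge-invariant state of one atom: a density matrix commuting with `a* a`. -/
def IsAtomState (η : Matrix (Fin 2) (Fin 2) ℂ) : Prop :=
  η.PosSemidef ∧ η.trace = 1 ∧ Commute η atomNumber

/-- The probability `p = Tr (a* a η)` that an atom in the state `η` is excited. -/
def excitationProb (η : Matrix (Fin 2) (Fin 2) ℂ) : ℝ := (atomNumber * η).trace.re

/-- Basis labels of the space `(ℂ²)^{⊗ M}` of `M` atoms. -/
abbrev Beam (M : ℕ) : Type := Fin M → Fin 2

/-- The operator on `(ℂ²)^{⊗ M}` that acts as `A` on the atom `k` and as the identity on the other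
atoms. -/
def onAtom {M : ℕ} (k : Fin M) (A : Matrix (Fin 2) (Fin 2) ℂ) : Matrix (Beam M) (Beam M) ℂ :=
  Matrix.of fun ω ω' => if ∀ j, j ≠ k → ω j = ω' j then A (ω k) (ω' k) else 0

/-- The homogeneous product state `η ⊗ ⋯ ⊗ η` of `M` atoms. -/
def beamState (M : ℕ) (η : Matrix (Fin 2) (Fin 2) ℂ) : Matrix (Beam M) (Beam M) ℂ :=
  Matrix.of fun ω ω' => ∏ k, η (ω k) (ω' k)

/-! ### The composite system: the cavity and `M` atoms -/

/-- The Hilbert space of the cavity and `M` atoms, `ℓ²(ℕ) ⊗ (ℂ²)^{⊗ M}`, written as the Hilbert sum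
of copies of the cavity space over the basis labels of the atoms. -/
abbrev System (M : ℕ) : Type := PiLp 2 (fun _ : Beam M => Cavity)

/-- The isometry `x ↦ x ⊗ |ω⟩`. -/
def embed {M : ℕ} (ω : Beam M) : Cavity →L[ℂ] System M :=
  (PiLp.continuousLinearEquiv 2 ℂ (fun _ : Beam M => Cavity)).symm.toContinuousLinearMap ∘L
    ContinuousLinearMap.single ℂ (fun _ : Beam M => Cavity) ω

/-- The adjoint of `embed ω`: the component at `|ω⟩`. -/
def component {M : ℕ} (ω : Beam M) : System M →L[ℂ] Cavity :=
  PiLp.proj 2 (fun _ : Beam M => Cavity) ω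

/-- The operator `ρ ⊗ A`. -/
def tensorOp {M : ℕ} (ρ : Cavity →L[ℂ] Cavity) (A : Matrix (Beam M) (Beam M) ℂ) :
    System M →L[ℂ] System M :=
  ∑ ω, ∑ ω', A ω ω' • (embed ω ∘L ρ ∘L component ω')

/-- The partial trace over the atoms. -/
def traceAtoms {M : ℕ} (ρ : System M →L[ℂ] System M) : Cavity →L[ℂ] Cavity :=
  ∑ ω, component ω ∘L ρ ∘L embed ω

/-- A normal state (density matrix) of the composite system: a positive operator of trace one. -/
def IsSystemState {M : ℕ} (ρ : System M →L[ℂ] System M) : Prop :=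
  ρ.IsPositive ∧
    HasSum (fun i : Beam M × ℕ => ⟪embed i.1 (fock i.2), ρ (embed i.1 (fock i.2))⟫_ℂ) 1

/-- Finite-particle vectors of the composite system. -/
abbrev FinSystem (M : ℕ) : Type := Beam M → FinCavity

/-- The inclusion of the finite-particle vectors into the space of the composite system. -/
def FinSystem.toSystem {M : ℕ} (x : FinSystem M) : System M :=
  WithLp.toLp 2 fun ω => (x ω).toCavity

/-- The operator `B ⊗ 1` on finite-particle vectors. -/
def onCavity (M : ℕ) (B : FinCavity →ₗ[ℂ] FinCavity) : FinSystem M →ₗ[ℂ] FinSystem M :=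
  LinearMap.pi fun ω => B ∘ₗ LinearMap.proj ω

/-- The operator `1 ⊗ A` on finite-particle vectors. -/
def onBeam {M : ℕ} (A : Matrix (Beam M) (Beam M) ℂ) : FinSystem M →ₗ[ℂ] FinSystem M :=
  LinearMap.pi fun ω => ∑ ω', A ω ω' • LinearMap.proj ω'

/-! ### The dynamics -/

/-- The time-dependent Hamiltonian
`H(t) = ε b* b ⊗ 1 + ∑ₖ 1 ⊗ E aₖ* aₖ + ∑ₖ χₖ(t) g (b* + b) ⊗ aₖ* aₖ`.
The atoms are numbered from `0`: the atom `k` is in the cavity for `k τ ≤ t < (k + 1) τ`. -/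
def hamiltonian (ε E g τ : ℝ) (M : ℕ) (t : ℝ) : FinSystem M →ₗ[ℂ] FinSystem M :=
  (ε : ℂ) • onCavity M photonOp
    + ∑ k : Fin M, (E : ℂ) • onBeam (onAtom k atomNumber)
    + ∑ k : Fin M,
        (Set.Ico ((k : ℝ) * τ) (((k : ℝ) + 1) * τ)).indicator (fun _ => (g : ℂ)) t •
          (onCavity M (creat + annih) ∘ₗ onBeam (onAtom k atomNumber))

/-- The matrix element `⟨x, L(ρ) y⟩`, for finite-particle vectors `x` and `y`, of
`L(ρ) = -i [H, ρ] + σ b ρ b* - (σ / 2) {b* b, ρ}`. The unbounded operators are moved to the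
vectors. -/
def lindbladForm {M : ℕ} (H : FinSystem M →ₗ[ℂ] FinSystem M) (σ : ℝ)
    (ρ : System M →L[ℂ] System M) (x y : FinSystem M) : ℂ :=
  -Complex.I * (⟪(H x).toSystem, ρ y.toSystem⟫_ℂ - ⟪x.toSystem, ρ (H y).toSystem⟫_ℂ)
    + σ * ⟪(onCavity M creat x).toSystem, ρ (onCavity M creat y).toSystem⟫_ℂ
    - (σ / 2) * (⟪(onCavity M photonOp x).toSystem, ρ y.toSystem⟫_ℂ
        + ⟪x.toSystem, ρ (onCavity M photonOp y).toSystem⟫_ℂ)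

/-- `ρ` is the evolution, during the passage `0 ≤ t ≤ M τ` of `M` atoms, of the state of the leaking
cavity and the beam that starts at `ρC ⊗ η ⊗ ⋯ ⊗ η`: a solution with values in the states of the
Cauchy problem `dρ/dt = L(t)(ρ)`, in the sense of matrix elements between finite-particle vectors.
The derivative is the right one, since `H(t)` jumps (and is right continuous) at the multiples
of `τ`. -/
structure IsEvolution (ε E g σ τ : ℝ) (ρC : Cavity →L[ℂ] Cavity) (η : Matrix (Fin 2) (Fin 2) ℂ)
    (M : ℕ) (ρ : ℝ → System M →L[ℂ] System M) : Prop where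
  isState : ∀ t ∈ Set.Icc 0 (M * τ), IsSystemState (ρ t)
  initial : ρ 0 = tensorOp ρC (beamState M η)
  continuousOn : ∀ x y : FinSystem M,
    ContinuousOn (fun t => ⟪x.toSystem, ρ t y.toSystem⟫_ℂ) (Set.Icc 0 (M * τ))
  hasDerivWithinAt : ∀ x y : FinSystem M, ∀ t ∈ Set.Ico 0 (M * τ),
    HasDerivWithinAt (fun s => ⟪x.toSystem, ρ s y.toSystem⟫_ℂ)
      (lindbladForm (hamiltonian ε E g τ M t) σ (ρ t) x y) (Set.Ici t) t

end LeakyCavity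

end

noncomputable section

namespace LeakyCavity

/-! ### The damped and driven mode in matrix elements -/

/-! The Hamiltonian is diagonal in the occupation numbers of the atoms. Hence for each configuration
`ω` of the beam the diagonal block of the state at `ω` evolves on its own, as a damped oscillator
driven with strength `g` times the occupation of the atom now in the cavity, and the photon number
sees only these blocks. For the trace `P`, the mean amplitude `A = Tr (b ρ)` and the first moment
`N` of a block one expects `P' = 0`, `A' = -μ A - i g P` and `N' = -σ N - 2 g Im A`. This linear
system is solved over one passage in `amplitude_step` and `number_step`.

The analytic difficulty is that the equation is known only for single matrix elements, whereas `P`,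
`A`, `N` are infinite sums with unbounded coefficients. The key estimate is `flux_le`: damping
absorbs the driving up to a bounded rate, so `∑ (K - j)₊ r_jj` decreases at rate at most `g² / σ`,
whatever `K`. Division by `K` shows that no block loses trace (`tsum_le_tsum`); as the traces of all
blocks add up to one, each is constant. The same estimate keeps `N` finite (`number_bounded`). The
equation for `N` then follows by dominated convergence (`number_eq`), and that for `A` by Cesàro
averaging, which tames a boundary term (`amplitude_eq`).

Finally the blocks are summed over `ω`. In the product state an atom that has not yet passed is
independent of the earlier ones, so its correlation with `A` has a closed form
(`sum_occupation_amplitude`). This turns the equation for `N` into a scalar recursion solved by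
`numberFormula`. -/

/-- The derivative of the matrix element `r j k` of a damped mode with linear driving `g`. -/
def modeRate (ε g σ : ℝ) (r : ℕ → ℕ → ℂ) (j k : ℕ) : ℂ :=
  -Complex.I * (ε * (j - k) * r j k
      + g * (√((j : ℝ) + 1) * r (j + 1) k + √(j : ℝ) * r (j - 1) k
          - √((k : ℝ) + 1) * r j (k + 1) - √(k : ℝ) * r j (k - 1)))
    + σ * (√((j : ℝ) + 1) * √((k : ℝ) + 1)) * r (j + 1) (k + 1) - σ / 2 * (j + k) * r j k

/-- Matrix elements of a positive trace class operator with trace at most one that evolve, for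
`a ≤ t ≤ b`, as a damped mode with linear driving `g`. -/
structure IsDrivenMode (ε g σ a b : ℝ) (r : ℕ → ℕ → ℝ → ℂ) : Prop where
  continuousOn : ∀ j k, ContinuousOn (r j k) (Set.Icc a b)
  hasDerivWithinAt : ∀ j k, ∀ t ∈ Set.Ico a b,
    HasDerivWithinAt (r j k) (modeRate ε g σ (fun j k => r j k t) j k) (Set.Ici t) t
  conj_symm : ∀ j k, ∀ t ∈ Set.Icc a b, (starRingEnd ℂ) (r j k t) = r k j t
  nonneg : ∀ j, ∀ t ∈ Set.Icc a b, 0 ≤ (r j j t).re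
  norm_sq_le : ∀ j k, ∀ t ∈ Set.Icc a b, ‖r j k t‖ ^ 2 ≤ (r j j t).re * (r k k t).re
  summable : ∀ t ∈ Set.Icc a b, Summable fun j => (r j j t).re
  tsum_le_one : ∀ t ∈ Set.Icc a b, ∑' j, (r j j t).re ≤ 1

/-- The number-weighted current from level `m - 1` to level `m` caused by the driving. -/
def flux (g : ℝ) (r : ℕ → ℕ → ℝ → ℂ) (m : ℕ) (t : ℝ) : ℝ :=
  2 * g * √(m : ℝ) * (r (m - 1) m t).im

/-- The sum of the first `K` partial traces. -/
def traceSum (r : ℕ → ℕ → ℝ → ℂ) (K : ℕ) (t : ℝ) : ℝ :=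
  ∑ m ∈ Finset.range K, ∑ j ∈ Finset.range (m + 1), (r j j t).re

/-- The truncated first moment `∑ j < K, j r_jj`. -/
def partialNumber (r : ℕ → ℕ → ℝ → ℂ) (K : ℕ) (t : ℝ) : ℝ :=
  ∑ j ∈ Finset.range K, (j : ℝ) * (r j j t).re

/-- Summation by parts: level `j ≤ K` is counted `K - j` times in `traceSum r K`. -/
theorem traceSum_eq (r : ℕ → ℕ → ℝ → ℂ) (K : ℕ) (t : ℝ) :
    K * ∑ j ∈ Finset.range (K + 1), (r j j t).re - traceSum r K t = partialNumber r (K + 1) t := by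
  induction K with
  | zero => simp [traceSum, partialNumber]
  | succ K ih =>
    have h1 : traceSum r (K + 1) t
        = traceSum r K t + ∑ j ∈ Finset.range (K + 1), (r j j t).re := Finset.sum_range_succ _ _
    have h2 : partialNumber r (K + 1 + 1) t
        = partialNumber r (K + 1) t + ((K + 1 : ℕ) : ℝ) * (r (K + 1) (K + 1) t).re :=
      Finset.sum_range_succ _ _
    rw [h1, h2, ← ih, Finset.sum_range_succ _ (K + 1)]
    push_cast
    ring

/-! ### Balance of populations and monotonicity of the trace -/

namespace IsDrivenMode

variable {ε g σ a b : ℝ} {r : ℕ → ℕ → ℝ → ℂ}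

theorem norm_le (h : IsDrivenMode ε g σ a b r) (j k : ℕ) {t : ℝ} (ht : t ∈ Set.Icc a b) :
    ‖r j k t‖ ≤ ((r j j t).re + (r k k t).re) / 2 := by
  have h1 := h.norm_sq_le j k t ht
  have h2 := h.nonneg j t ht
  have h3 := h.nonneg k t ht
  refine le_of_sq_le_sq ?_ (by positivity)
  nlinarith [sq_nonneg ((r j j t).re - (r k k t).re)]

/-- A discrete continuity equation: the net upward current from level `j - 1` to `j` minus that from
`j` to `j + 1`, so that sums over `j` telescope. -/
theorem hasDerivWithinAt_diag (h : IsDrivenMode ε g σ a b r) (j : ℕ) {t : ℝ}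
    (ht : t ∈ Set.Ico a b) :
    HasDerivWithinAt (fun t => (r j j t).re)
      ((flux g r j t - σ * j * (r j j t).re)
        - (flux g r (j + 1) t - σ * (j + 1) * (r (j + 1) (j + 1) t).re)) (Set.Ici t) t := by
  have h1 := Complex.reCLM.hasFDerivAt.comp_hasDerivWithinAt t (h.hasDerivWithinAt j j t ht)
  have ht' := Set.Ico_subset_Icc_self ht
  refine h1.congr_deriv ?_
  have c1 := h.conj_symm j (j + 1) t ht'
  have c2 := h.conj_symm (j - 1) j t ht'
  have hs : (√((j : ℝ) + 1) : ℂ) * √((j : ℝ) + 1) = ((j : ℝ) + 1 : ℝ) := by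
    rw [← Complex.ofReal_mul, Real.mul_self_sqrt (by positivity)]
  simp only [modeRate, flux, hs, ← c1, ← c2, Complex.reCLM_apply]
  simp [Complex.ofReal_re]
  ring

theorem hasDerivWithinAt_traceSum (h : IsDrivenMode ε g σ a b r) (K : ℕ) {t : ℝ}
    (ht : t ∈ Set.Ico a b) :
    HasDerivWithinAt (traceSum r K)
      (σ * partialNumber r (K + 1) t - ∑ m ∈ Finset.range K, flux g r (m + 1) t)
      (Set.Ici t) t := by
  have h1 := HasDerivWithinAt.fun_sum (u := Finset.range K) fun m _ =>
    HasDerivWithinAt.fun_sum (u := Finset.range (m + 1)) fun j _ => h.hasDerivWithinAt_diag j ht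
  refine h1.congr_deriv ?_
  have h2 : ∀ m, (∑ j ∈ Finset.range (m + 1), ((flux g r j t - σ * j * (r j j t).re)
      - (flux g r (j + 1) t - σ * (j + 1) * (r (j + 1) (j + 1) t).re))) =
      σ * ((m + 1 : ℕ) * (r (m + 1) (m + 1) t).re) - flux g r (m + 1) t := by
    intro m
    -- The current into level `0` vanishes, as the factors `√0` and `0` kill the spurious index `0 -
    -- 1`.
    have := Finset.sum_range_sub' (fun j => flux g r j t - σ * j * (r j j t).re) (m + 1)
    push_cast at this ⊢
    rw [this]
    simp [flux]
    ring
  rw [Finset.sum_congr rfl fun m _ => h2 m, Finset.sum_sub_distrib, ← Finset.mul_sum,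
    partialNumber, Finset.sum_range_succ']
  simp

theorem continuousOn_diag (h : IsDrivenMode ε g σ a b r) (j : ℕ) :
    ContinuousOn (fun t => (r j j t).re) (Set.Icc a b) :=
  Complex.continuous_re.comp_continuousOn (h.continuousOn j j)

theorem continuousOn_traceSum (h : IsDrivenMode ε g σ a b r) (K : ℕ) :
    ContinuousOn (traceSum r K) (Set.Icc a b) :=
  continuousOn_finsetSum _ fun _ _ => continuousOn_finsetSum _ fun j _ => h.continuousOn_diag j

theorem continuousOn_partialNumber (h : IsDrivenMode ε g σ a b r) (K : ℕ) :
    ContinuousOn (partialNumber r K) (Set.Icc a b) :=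
  continuousOn_finsetSum _ fun j _ => continuousOn_const.mul (h.continuousOn_diag j)

theorem continuousOn_flux (h : IsDrivenMode ε g σ a b r) (m : ℕ) :
    ContinuousOn (flux g r m) (Set.Icc a b) :=
  continuousOn_const.mul (Complex.continuous_im.comp_continuousOn (h.continuousOn _ _))

theorem sum_le_one (h : IsDrivenMode ε g σ a b r) (s : Finset ℕ) {t : ℝ} (ht : t ∈ Set.Icc a b) :
    ∑ j ∈ s, (r j j t).re ≤ 1 :=
  ((h.summable t ht).sum_le_tsum s fun j _ => h.nonneg j t ht).trans (h.tsum_le_one t ht)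

/-- Damping controls the driving: the energy current is at most a multiple of the population. -/
theorem flux_le (h : IsDrivenMode ε g σ a b r) (hσ : 0 < σ) (m : ℕ) {t : ℝ}
    (ht : t ∈ Set.Icc a b) :
    flux g r (m + 1) t ≤
      σ * ((m + 1 : ℕ) * (r (m + 1) (m + 1) t).re) + g ^ 2 / σ * (r m m t).re := by
  have h0 := h.nonneg m t ht
  have h1 := h.nonneg (m + 1) t ht
  have h2 := h.norm_sq_le m (m + 1) t ht
  have h3 : (r m (m + 1) t).im ^ 2 ≤ ‖r m (m + 1) t‖ ^ 2 := by
    rw [← sq_abs]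
    exact pow_le_pow_left₀ (abs_nonneg _) (Complex.abs_im_le_norm _) 2
  refine (abs_le_of_sq_le_sq' ?_ (by positivity)).2
  simp only [flux, Nat.add_sub_cancel]
  have hs : √((m + 1 : ℕ) : ℝ) ^ 2 = (m + 1 : ℕ) := Real.sq_sqrt (by positivity)
  set x := (r m m t).re
  set y := (r (m + 1) (m + 1) t).re
  -- The two bounding terms are weighted so that `σ` cancels in their product; `4 X Y ≤ (X + Y)²`
  -- and Cauchy–Schwarz then give the claim.
  have hx : (σ * ((m + 1 : ℕ) * y)) * (g ^ 2 / σ * x) = g ^ 2 * (m + 1 : ℕ) * (x * y) := by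
    field_simp
  have h4 : g ^ 2 * (m + 1 : ℕ) * (r m (m + 1) t).im ^ 2 ≤ g ^ 2 * (m + 1 : ℕ) * (x * y) :=
    mul_le_mul_of_nonneg_left (h3.trans h2) (by positivity)
  have h5 : (2 * g * √((m + 1 : ℕ) : ℝ) * (r m (m + 1) t).im) ^ 2
      = 4 * (g ^ 2 * (m + 1 : ℕ) * (r m (m + 1) t).im ^ 2) := by
    rw [mul_pow, mul_pow, mul_pow, hs]; ring
  rw [h5]
  nlinarith [sq_nonneg (σ * ((m + 1 : ℕ) * y) - g ^ 2 / σ * x)]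

/-- The damping part of the rate, `σ` times the truncated first moment, cancels the matching part of
`flux_le`. What is left is `g² / σ` times a partial trace, at most `g² / σ`, so the loss is bounded
uniformly in `K`. -/
theorem traceSum_sub_le (h : IsDrivenMode ε g σ a b r) (hσ : 0 < σ) (K : ℕ) {t : ℝ}
    (ht : t ∈ Set.Icc a b) :
    traceSum r K a - g ^ 2 / σ * (t - a) ≤ traceSum r K t := by
  have key := image_le_of_deriv_right_le_deriv_boundary (a := a) (b := b)
    (f := fun t => -traceSum r K t) (B := fun t => -traceSum r K a + g ^ 2 / σ * (t - a))
    (B' := fun _ => g ^ 2 / σ)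
    (h.continuousOn_traceSum K).neg (fun x hx => (h.hasDerivWithinAt_traceSum K hx).neg)
    (by simp) (by fun_prop)
    (fun x _ => by
      simpa using (((hasDerivAt_id x).sub_const a).const_mul (g ^ 2 / σ)).const_add
        (-traceSum r K a) |>.hasDerivWithinAt) ?_ ht
  · linarith
  · intro x hx
    have hx' := Set.Ico_subset_Icc_self hx
    have h1 := Finset.sum_le_sum fun m (_ : m ∈ Finset.range K) => h.flux_le hσ m hx'
    rw [Finset.sum_add_distrib, ← Finset.mul_sum, ← Finset.mul_sum] at h1
    have h2 : partialNumber r (K + 1) x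
        = ∑ m ∈ Finset.range K, ((m + 1 : ℕ) : ℝ) * (r (m + 1) (m + 1) x).re := by
      rw [partialNumber, Finset.sum_range_succ']; simp
    have h3 : g ^ 2 / σ * ∑ m ∈ Finset.range K, (r m m x).re ≤ g ^ 2 / σ * 1 :=
      mul_le_mul_of_nonneg_left (h.sum_le_one _ hx') (by positivity)
    rw [h2]
    linarith

/-- The trace does not decrease. -/
theorem tsum_le_tsum (h : IsDrivenMode ε g σ a b r) (hσ : 0 < σ) {t : ℝ}
    (ht : t ∈ Set.Icc a b) : ∑' j, (r j j a).re ≤ ∑' j, (r j j t).re := by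
  have ha : a ∈ Set.Icc a b := ⟨le_rfl, ht.1.trans ht.2⟩
  -- `traceSum r K / K` is a Cesàro mean of partial traces and tends to the trace, while the loss,
  -- independent of `K`, disappears on division by `K`.
  have hlim : ∀ s ∈ Set.Icc a b, Tendsto (fun K : ℕ => (K : ℝ)⁻¹ • traceSum r K s) atTop
      (𝓝 (∑' j, (r j j s).re)) := fun s hs =>
    (((h.summable s hs).hasSum.tendsto_sum_nat).comp (tendsto_add_atTop_nat 1)).cesaro_smul
  have h0 : Tendsto (fun K : ℕ => (K : ℝ)⁻¹ • (g ^ 2 / σ * (t - a))) atTop (𝓝 0) := by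
    simpa using (tendsto_inv_atTop_nhds_zero_nat (𝕜 := ℝ)).smul_const (g ^ 2 / σ * (t - a))
  have h1 := (hlim a ha).sub h0
  rw [sub_zero] at h1
  refine le_of_tendsto_of_tendsto' h1 (hlim t ht) fun K => ?_
  rw [← smul_sub]
  exact smul_le_smul_of_nonneg_left (h.traceSum_sub_le hσ K ht) (by positivity)

end IsDrivenMode


/-! ### The photon number of one driven mode -/

/-- The first moment `∑ j, j r_jj`. -/
def modeNumber (r : ℕ → ℕ → ℝ → ℂ) (t : ℝ) : ℝ := ∑' j : ℕ, (j : ℝ) * (r j j t).re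

/-- The terms of the mean amplitude `∑ j, √(j + 1) r_{j+1,j}`. -/
def amplitudeTerm (r : ℕ → ℕ → ℝ → ℂ) (j : ℕ) (t : ℝ) : ℂ := √((j : ℝ) + 1) * r (j + 1) j t

/-- The mean amplitude, that is the expectation of the annihilation operator. -/
def amplitude (r : ℕ → ℕ → ℝ → ℂ) (t : ℝ) : ℂ := ∑' j, amplitudeTerm r j t

namespace IsDrivenMode

variable {ε g σ a b : ℝ} {r : ℕ → ℕ → ℝ → ℂ} {P B : ℝ}

/-- `traceSum r K` gives level `j` the weight `(K - j)₊ = K - min j K`. With `P` conserved, this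
makes the bounded cut-off `min j K` of the number operator accessible through the rate of
`traceSum`, without assuming a finite first moment. -/
theorem hasSum_min (P t : ℝ) (hP : HasSum (fun j => (r j j t).re) P) (K : ℕ) :
    HasSum (fun j => (min j K : ℕ) * (r j j t).re) (K * P - traceSum r K t) := by
  induction K with
  | zero => simp [traceSum]
  | succ K ih =>
    have h1 : traceSum r (K + 1) t
        = traceSum r K t + ∑ j ∈ Finset.range (K + 1), (r j j t).re := Finset.sum_range_succ _ _
    have h2 : HasSum (fun j => if j ∈ Finset.range (K + 1) then (r j j t).re else 0)
        (∑ j ∈ Finset.range (K + 1), (r j j t).re) := by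
      rw [← Finset.sum_congr rfl fun j hj => if_pos hj]
      exact hasSum_sum_of_ne_finset_zero fun j hj => if_neg hj
    have h3 := ih.add (hP.sub h2)
    rw [h1]
    convert h3 using 1
    · funext j
      by_cases hj : j < K + 1
      · rw [if_pos (Finset.mem_range.2 hj), min_eq_left hj.le, min_eq_left (by omega)]; ring
      · rw [if_neg (by simpa using hj), min_eq_right (by omega), min_eq_right (by omega)]
        push_cast; ring
    · push_cast; ring

theorem partialNumber_le (h : IsDrivenMode ε g σ a b r) {t : ℝ} (ht : t ∈ Set.Icc a b)
    (hP : HasSum (fun j => (r j j t).re) P) (K : ℕ) :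
    partialNumber r (K + 1) t ≤ K * P - traceSum r K t := by
  rw [← traceSum_eq]
  have := sum_le_hasSum (Finset.range (K + 1)) (fun j _ => h.nonneg j t ht) hP
  gcongr

theorem number_term_nonneg (h : IsDrivenMode ε g σ a b r) {t : ℝ} (ht : t ∈ Set.Icc a b)
    (j : ℕ) : 0 ≤ (j : ℝ) * (r j j t).re :=
  mul_nonneg (Nat.cast_nonneg _) (h.nonneg j t ht)

theorem cut_le_number (h : IsDrivenMode ε g σ a b r) {t : ℝ} (ht : t ∈ Set.Icc a b)
    (hP : HasSum (fun j => (r j j t).re) P)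
    (hN : Summable fun j : ℕ => (j : ℝ) * (r j j t).re) (K : ℕ) :
    K * P - traceSum r K t ≤ modeNumber r t :=
  hasSum_le (fun j => mul_le_mul_of_nonneg_right (by exact_mod_cast min_le_left j K)
    (h.nonneg j t ht)) (hasSum_min P t hP K) hN.hasSum

/-- A finite first moment stays finite. -/
theorem number_bounded (h : IsDrivenMode ε g σ a b r) (hσ : 0 < σ)
    (hP : ∀ t ∈ Set.Icc a b, HasSum (fun j => (r j j t).re) P)
    (hN : Summable fun j : ℕ => (j : ℝ) * (r j j a).re) {t : ℝ} (ht : t ∈ Set.Icc a b) :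
    (Summable fun j : ℕ => (j : ℝ) * (r j j t).re) ∧
      modeNumber r t ≤ modeNumber r a + g ^ 2 / σ * (b - a) := by
  have ha : a ∈ Set.Icc a b := ⟨le_rfl, ht.1.trans ht.2⟩
  have hc : 0 ≤ g ^ 2 / σ := by positivity
  -- The partial first moment at `t` is below the cut-off moment at `t`, which has grown by at most
  -- `g² / σ * (t - a)`, and the cut-off moment at `a` is below `modeNumber r a`.
  have key : ∀ K, ∑ j ∈ Finset.range K, (j : ℝ) * (r j j t).re
      ≤ modeNumber r a + g ^ 2 / σ * (b - a) := by
    intro K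
    have h1 := h.partialNumber_le ht (hP t ht) K
    have h2 := h.traceSum_sub_le hσ K ht
    have h3 := h.cut_le_number ha (hP a ha) hN K
    have h4 : g ^ 2 / σ * (t - a) ≤ g ^ 2 / σ * (b - a) :=
      mul_le_mul_of_nonneg_left (by linarith [ht.2]) hc
    have h5 : ∑ j ∈ Finset.range K, (j : ℝ) * (r j j t).re ≤ partialNumber r (K + 1) t :=
      Finset.sum_le_sum_of_subset_of_nonneg (Finset.range_mono (Nat.le_succ K))
        fun j _ _ => h.number_term_nonneg ht j
    linarith
  have hs := summable_of_sum_range_le (fun j => h.number_term_nonneg ht j) key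
  exact ⟨hs, hs.tsum_le_of_sum_range_le key⟩

theorem tendsto_partialNumber {t : ℝ} (hN : Summable fun j : ℕ => (j : ℝ) * (r j j t).re) :
    Tendsto (fun K => partialNumber r (K + 1) t) atTop (𝓝 (modeNumber r t)) :=
  hN.hasSum.tendsto_sum_nat.comp (tendsto_add_atTop_nat 1)

theorem tendsto_cut (h : IsDrivenMode ε g σ a b r) {t : ℝ} (ht : t ∈ Set.Icc a b)
    (hP : HasSum (fun j => (r j j t).re) P)
    (hN : Summable fun j : ℕ => (j : ℝ) * (r j j t).re) :
    Tendsto (fun K : ℕ => K * P - traceSum r K t) atTop (𝓝 (modeNumber r t)) :=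
  tendsto_of_tendsto_of_tendsto_of_le_of_le (tendsto_partialNumber hN) tendsto_const_nhds
    (h.partialNumber_le ht hP) (h.cut_le_number ht hP hN)

/-- The terms dominate those of the amplitude, through `√(j + 1) ≤ j + 1` and `norm_le`; thus a
finite first moment makes the amplitude converge absolutely. -/
theorem hasSum_amplitude_bound {t : ℝ} (hP : HasSum (fun j => (r j j t).re) P)
    (hN : Summable fun j : ℕ => (j : ℝ) * (r j j t).re) :
    HasSum (fun j : ℕ => ((j : ℝ) * (r j j t).re + (r j j t).re
      + (j + 1 : ℕ) * (r (j + 1) (j + 1) t).re) / 2) ((2 * modeNumber r t + P) / 2) := by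
  have h1 : HasSum (fun j : ℕ => ((j + 1 : ℕ) : ℝ) * (r (j + 1) (j + 1) t).re)
      (modeNumber r t) := by
    have := (hasSum_nat_add_iff' 1).2 hN.hasSum
    simpa [modeNumber] using this
  have h2 : HasSum (fun j : ℕ => (j : ℝ) * (r j j t).re) (modeNumber r t) := hN.hasSum
  rw [two_mul, add_right_comm]
  exact ((h2.add hP).add h1).div_const 2

theorem norm_amplitudeTerm_le (h : IsDrivenMode ε g σ a b r) {t : ℝ} (ht : t ∈ Set.Icc a b)
    (j : ℕ) : ‖amplitudeTerm r j t‖ ≤ ((j : ℝ) * (r j j t).re + (r j j t).re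
      + (j + 1 : ℕ) * (r (j + 1) (j + 1) t).re) / 2 := by
  have h1 : √((j : ℝ) + 1) ≤ j + 1 := by
    rw [Real.sqrt_le_left (by positivity)]
    nlinarith [(Nat.cast_nonneg j : (0 : ℝ) ≤ j)]
  rw [amplitudeTerm, norm_mul, Complex.norm_real, Real.norm_of_nonneg (Real.sqrt_nonneg _)]
  refine (mul_le_mul h1 (h.norm_le (j + 1) j ht) (norm_nonneg _) (by positivity)).trans ?_
  push_cast
  linarith

theorem summable_norm_amplitudeTerm (h : IsDrivenMode ε g σ a b r) {t : ℝ}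
    (ht : t ∈ Set.Icc a b) (hP : HasSum (fun j => (r j j t).re) P)
    (hN : Summable fun j : ℕ => (j : ℝ) * (r j j t).re) :
    Summable fun j => ‖amplitudeTerm r j t‖ :=
  (hasSum_amplitude_bound hP hN).summable.of_nonneg_of_le (fun _ => norm_nonneg _)
    (h.norm_amplitudeTerm_le ht)

theorem sum_norm_amplitudeTerm_le (h : IsDrivenMode ε g σ a b r) {t : ℝ}
    (ht : t ∈ Set.Icc a b) (hP : HasSum (fun j => (r j j t).re) P)
    (hN : Summable fun j : ℕ => (j : ℝ) * (r j j t).re) (s : Finset ℕ) :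
    ∑ j ∈ s, ‖amplitudeTerm r j t‖ ≤ modeNumber r t + 1 := by
  have h1 := (h.summable_norm_amplitudeTerm ht hP hN).sum_le_tsum s fun _ _ => norm_nonneg _
  have h2 := (h.summable_norm_amplitudeTerm ht hP hN).tsum_le_tsum
    (h.norm_amplitudeTerm_le ht) (hasSum_amplitude_bound hP hN).summable
  rw [(hasSum_amplitude_bound hP hN).tsum_eq] at h2
  have h3 := h.tsum_le_one t ht
  rw [hP.tsum_eq] at h3
  linarith

theorem flux_succ (h : IsDrivenMode ε g σ a b r) {t : ℝ} (ht : t ∈ Set.Icc a b) (j : ℕ) :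
    flux g r (j + 1) t = -2 * g * (amplitudeTerm r j t).im := by
  rw [flux, amplitudeTerm, Nat.add_sub_cancel, ← h.conj_symm (j + 1) j t ht,
    Complex.im_ofReal_mul, Complex.conj_im]
  push_cast
  ring

/-- The first moment of the damped and driven mode solves `N' = -2 g Im A - σ N`. -/
theorem number_eq (h : IsDrivenMode ε g σ a b r) (hab : a ≤ b) (hσ : 0 < σ)
    (hP : ∀ t ∈ Set.Icc a b, HasSum (fun j => (r j j t).re) P)
    (hN : ∀ t ∈ Set.Icc a b, Summable fun j : ℕ => (j : ℝ) * (r j j t).re)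
    (hB : ∀ t ∈ Set.Icc a b, modeNumber r t ≤ B)
    {Y F : ℝ → ℝ} (hF : ∀ t ∈ Set.Icc a b, F t = -2 * g * (amplitude r t).im)
    (hFc : Continuous F) (hY : ∀ t, HasDerivAt Y (F t - σ * Y t) t)
    (hYa : Y a = modeNumber r a) : modeNumber r b = Y b := by
  have ha : a ∈ Set.Icc a b := ⟨le_rfl, hab⟩
  have hb : b ∈ Set.Icc a b := ⟨hab, le_rfl⟩
  have hYc : Continuous Y := continuous_iff_continuousAt.2 fun t => (hY t).continuousAt
  -- Differentiability of the first moment is not available, so the cut-off moment is compared with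
  -- the candidate `Y` under the integrating factor `exp (σ t)`. `W K` is the right derivative of `V
  -- K`; its two brackets measure the mismatch of the two truncations and the missing tail of the
  -- flux.
  set V : ℕ → ℝ → ℝ := fun K t => Real.exp (σ * t) * ((K * P - traceSum r K t) - Y t) with hV
  set W : ℕ → ℝ → ℝ := fun K t => Real.exp (σ * t) *
    (σ * ((K * P - traceSum r K t) - partialNumber r (K + 1) t)
      + (∑ m ∈ Finset.range K, flux g r (m + 1) t - F t)) with hW
  have hexp : Continuous fun t : ℝ => Real.exp (σ * t) := by fun_prop
  have hVc : ∀ K, ContinuousOn (V K) (Set.Icc a b) := fun K =>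
    hexp.continuousOn.mul ((continuousOn_const.sub (h.continuousOn_traceSum K)).sub
      hYc.continuousOn)
  have hWc : ∀ K, ContinuousOn (W K) (Set.Icc a b) := fun K =>
    hexp.continuousOn.mul ((continuousOn_const.mul ((continuousOn_const.sub
      (h.continuousOn_traceSum K)).sub (h.continuousOn_partialNumber _))).add
      ((continuousOn_finsetSum _ fun m _ => h.continuousOn_flux (m + 1)).sub hFc.continuousOn))
  have hderiv : ∀ K, ∀ t ∈ Set.Ioo a b, HasDerivWithinAt (V K) (W K t) (Set.Ioi t) t := by
    intro K t ht
    have ht' : t ∈ Set.Ico a b := Set.Ioo_subset_Ico_self ht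
    have h1 := (h.hasDerivWithinAt_traceSum K ht').mono Set.Ioi_subset_Ici_self
    have h2 : HasDerivAt (fun t => Real.exp (σ * t)) (Real.exp (σ * t) * σ) t := by
      simpa using ((hasDerivAt_id t).const_mul σ).exp
    have h3 := h2.hasDerivWithinAt (s := Set.Ioi t) |>.mul
      ((h1.const_sub (K * P)).sub (hY t).hasDerivWithinAt)
    refine h3.congr_deriv ?_
    simp only [hW, Pi.sub_apply]
    ring
  have hint : ∀ K, ∫ t in a..b, W K t = V K b - V K a := fun K =>
    intervalIntegral.integral_eq_sub_of_hasDeriv_right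
      (by rw [Set.uIcc_of_le hab]; exact hVc K)
      (by rw [min_eq_left hab, max_eq_right hab]; exact hderiv K)
      (ContinuousOn.intervalIntegrable (by rw [Set.uIcc_of_le hab]; exact hWc K))
  have hfl : ∀ t ∈ Set.Icc a b,
      Tendsto (fun K => ∑ m ∈ Finset.range K, flux g r (m + 1) t) atTop (𝓝 (F t)) := by
    intro t ht
    have h1 := (h.summable_norm_amplitudeTerm ht (hP t ht) (hN t ht)).of_norm.hasSum
    have h2 := (Complex.hasSum_im h1).mul_left (-2 * g)
    rw [hF t ht]
    simp_rw [h.flux_succ ht]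
    exact h2.tendsto_sum_nat
  have hflb : ∀ t ∈ Set.Icc a b, ∀ K,
      |∑ m ∈ Finset.range K, flux g r (m + 1) t| ≤ 2 * |g| * (B + 1) := by
    intro t ht K
    have h1 : ∀ m ∈ Finset.range K, |flux g r (m + 1) t| ≤ 2 * |g| * ‖amplitudeTerm r m t‖ := by
      intro m _
      rw [h.flux_succ ht, abs_mul, abs_mul]
      have := Complex.abs_im_le_norm (amplitudeTerm r m t)
      norm_num
      gcongr
    refine (Finset.abs_sum_le_sum_abs _ _).trans ((Finset.sum_le_sum h1).trans ?_)
    rw [← Finset.mul_sum]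
    have := h.sum_norm_amplitudeTerm_le ht (hP t ht) (hN t ht) (Finset.range K)
    have := hB t ht
    gcongr
    linarith
  have hFb : ∀ t ∈ Set.Icc a b, |F t| ≤ 2 * |g| * (B + 1) := fun t ht =>
    le_of_tendsto' (hfl t ht).abs (hflb t ht)
  -- Both mismatches tend to zero pointwise and are bounded uniformly in `K` and `t`, so dominated
  -- convergence applies. In the limit the integrated equation forces `modeNumber r b = Y b`.
  have hlim0 : Tendsto (fun K => ∫ t in a..b, W K t) atTop (𝓝 (∫ _ in a..b, (0 : ℝ))) := by
    refine intervalIntegral.tendsto_integral_filter_of_dominated_convergence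
      (fun _ => Real.exp (σ * b) * (σ * B + 2 * (2 * |g| * (B + 1)))) ?_ ?_ ?_ ?_
    · refine Eventually.of_forall fun K => ?_
      rw [Set.uIoc_of_le hab]
      exact ((hWc K).mono Set.Ioc_subset_Icc_self).aestronglyMeasurable measurableSet_Ioc
    · refine Eventually.of_forall fun K => Eventually.of_forall fun t ht => ?_
      rw [Set.uIoc_of_le hab] at ht
      have ht' := Set.Ioc_subset_Icc_self ht
      have h1 := h.partialNumber_le ht' (hP t ht') K
      have h2 := h.cut_le_number ht' (hP t ht') (hN t ht') K
      have h3 : 0 ≤ partialNumber r (K + 1) t :=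
        Finset.sum_nonneg fun j _ => h.number_term_nonneg ht' j
      have h4 := hB t ht'
      rw [Real.norm_eq_abs, hW, abs_mul, Real.abs_exp]
      have h5 : |σ * ((K * P - traceSum r K t) - partialNumber r (K + 1) t)| ≤ σ * B := by
        rw [abs_of_nonneg (mul_nonneg hσ.le (by linarith))]
        exact mul_le_mul_of_nonneg_left (by linarith) hσ.le
      have h6 := abs_add_le (σ * ((K * P - traceSum r K t) - partialNumber r (K + 1) t))
        (∑ m ∈ Finset.range K, flux g r (m + 1) t - F t)
      have h7 := abs_sub (∑ m ∈ Finset.range K, flux g r (m + 1) t) (F t)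
      have h8 := hflb t ht' K
      have h9 := hFb t ht'
      refine mul_le_mul ?_ (by linarith) (abs_nonneg _) (Real.exp_pos _).le
      exact Real.exp_le_exp.2 (mul_le_mul_of_nonneg_left ht.2 hσ.le)
    · exact intervalIntegrable_const
    · refine Eventually.of_forall fun t ht => ?_
      rw [Set.uIoc_of_le hab] at ht
      have ht' := Set.Ioc_subset_Icc_self ht
      have h1 := ((h.tendsto_cut ht' (hP t ht') (hN t ht')).sub
        (tendsto_partialNumber (hN t ht'))).const_mul σ
      have h2 := (h1.add ((hfl t ht').sub_const (F t))).const_mul (Real.exp (σ * t))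
      simpa [hW] using h2
  have hVlim : ∀ t ∈ Set.Icc a b, Tendsto (fun K => V K t) atTop
      (𝓝 (Real.exp (σ * t) * (modeNumber r t - Y t))) := fun t ht =>
    ((h.tendsto_cut ht (hP t ht) (hN t ht)).sub_const (Y t)).const_mul _
  simp_rw [hint] at hlim0
  have heq := tendsto_nhds_unique hlim0 ((hVlim b hb).sub (hVlim a ha))
  rw [hYa, sub_self, mul_zero, sub_zero, intervalIntegral.integral_zero] at heq
  have := (mul_eq_zero.1 heq.symm).resolve_left (Real.exp_pos _).ne'
  linarith

end IsDrivenMode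


/-! ### The mean amplitude of one driven mode -/

namespace IsDrivenMode

variable {ε g σ a b : ℝ} {r : ℕ → ℕ → ℝ → ℂ} {P B : ℝ}

/-- The deviation of the rate of a partial sum of amplitudes from `-μ S - i g P`. -/
def amplitudeError (g σ P : ℝ) (r : ℕ → ℕ → ℝ → ℂ) (t : ℝ) (K : ℕ) : ℂ :=
  σ * (K * amplitudeTerm r K t)
    - Complex.I * g * (√(K : ℝ) * √((K : ℝ) + 1) * r (K + 1) (K - 1) t
      + (((∑ j ∈ Finset.range K, (r j j t).re) - P : ℝ) : ℂ) - ((K * (r K K t).re : ℝ) : ℂ))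

theorem ofReal_diag (h : IsDrivenMode ε g σ a b r) {t : ℝ} (ht : t ∈ Set.Icc a b) (j : ℕ) :
    (((r j j t).re : ℝ) : ℂ) = r j j t :=
  Complex.conj_eq_iff_re.1 (h.conj_symm j j t ht)

/-- The damping terms telescope to `-σ / 2` times the partial sum plus a boundary term. The driving
terms telescope likewise, because `[b, b*] = 1`, and leave the partial trace, which replaces `P` up
to a tail. -/
theorem sum_amplitudeRate (h : IsDrivenMode ε g σ a b r) {t : ℝ} (ht : t ∈ Set.Icc a b)
    (P : ℝ) (K : ℕ) :
    ∑ j ∈ Finset.range K, (√((j : ℝ) + 1) : ℂ) * modeRate ε g σ (fun j k => r j k t) (j + 1) j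
      = -(σ / 2 + Complex.I * ε) * ∑ j ∈ Finset.range K, amplitudeTerm r j t
        - Complex.I * g * P + amplitudeError g σ P r t K := by
  induction K with
  | zero => simp [amplitudeError]
  | succ K ih =>
    rw [Finset.sum_range_succ, Finset.sum_range_succ, ih]
    simp only [amplitudeError, amplitudeTerm, modeRate, Nat.add_sub_cancel]
    rw [Finset.sum_range_succ _ K]
    push_cast
    rw [h.ofReal_diag ht, h.ofReal_diag ht]
    have hs : (√((K : ℝ) + 1) : ℂ) * √((K : ℝ) + 1) = (K : ℂ) + 1 := by
      rw [← Complex.ofReal_mul, Real.mul_self_sqrt (by positivity)]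
      push_cast; rfl
    linear_combination (σ * √((K : ℝ) + 1 + 1) * r (K + 1 + 1) (K + 1) t
      - Complex.I * g * (r K K t - r (K + 1) (K + 1) t)) * hs

/-- A finite first moment does not give decay of `K * amplitudeTerm r K t`, but it bounds this by
`√(K + 1)` times a summable sequence. The other error terms have bounded sums, so the average over
`n + 1` values of `K` is of order `n ^ (-1/2)`. -/
theorem norm_amplitudeError_sum_le (h : IsDrivenMode ε g σ a b r) (hσ : 0 < σ) {t : ℝ}
    (ht : t ∈ Set.Icc a b) (hP : HasSum (fun j => (r j j t).re) P)
    (hN : Summable fun j : ℕ => (j : ℝ) * (r j j t).re) (hB : modeNumber r t ≤ B) (n : ℕ) :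
    ‖∑ K ∈ Finset.range (n + 1), amplitudeError g σ P r t K‖
      ≤ √((n : ℝ) + 1) * (σ * B + |g| * (3 * B + 3)) := by
  have hsq : 1 ≤ √((n : ℝ) + 1) := Real.one_le_sqrt.2 (by linarith [(Nat.cast_nonneg n : (0:ℝ) ≤ n)])
  have hP1 : P ≤ 1 := hP.tsum_eq ▸ h.tsum_le_one t ht
  have hB0 : 0 ≤ B := (tsum_nonneg (h.number_term_nonneg ht)).trans hB
  have hpn : ∀ K, partialNumber r K t ≤ B := fun K =>
    (hN.sum_le_tsum _ fun j _ => h.number_term_nonneg ht j).trans hB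
  have hshift : ∀ K, ∑ j ∈ Finset.range K, ((j : ℝ) + 1) * (r (j + 1) (j + 1) t).re ≤ B := by
    intro K
    have := hpn (K + 1)
    rw [partialNumber, Finset.sum_range_succ'] at this
    simpa using this
  have h1 : ∑ K ∈ Finset.range (n + 1), ‖(σ * (K * amplitudeTerm r K t) : ℂ)‖
      ≤ √((n : ℝ) + 1) * (σ * B) := by
    have hterm : ∀ K ∈ Finset.range (n + 1), ‖(σ * (K * amplitudeTerm r K t) : ℂ)‖
        ≤ √((n : ℝ) + 1) * (σ * ((K * (r K K t).re
          + (K + 1) * (r (K + 1) (K + 1) t).re) / 2)) := by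
      intro K hK
      have hKn : (K : ℝ) ≤ n := by exact_mod_cast Nat.lt_succ_iff.1 (Finset.mem_range.1 hK)
      have h2 : √((K : ℝ) + 1) ≤ √((n : ℝ) + 1) := Real.sqrt_le_sqrt (by linarith)
      have h3 := h.norm_le (K + 1) K ht
      have h4 := h.nonneg (K + 1) t ht
      rw [amplitudeTerm, norm_mul, norm_mul, norm_mul, Complex.norm_real, Complex.norm_real,
        Complex.norm_natCast, Real.norm_of_nonneg hσ.le, Real.norm_of_nonneg (Real.sqrt_nonneg _)]
      have h5 : (K : ℝ) * ‖r (K + 1) K t‖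
          ≤ (K * (r K K t).re + (K + 1) * (r (K + 1) (K + 1) t).re) / 2 := by
        have := mul_le_mul_of_nonneg_left h3 (Nat.cast_nonneg K : (0 : ℝ) ≤ K)
        linarith
      calc σ * (K * (√((K : ℝ) + 1) * ‖r (K + 1) K t‖))
          = √((K : ℝ) + 1) * (σ * (K * ‖r (K + 1) K t‖)) := by ring
        _ ≤ _ := by gcongr
    refine (Finset.sum_le_sum hterm).trans ?_
    rw [← Finset.mul_sum, ← Finset.mul_sum, ← Finset.sum_div, Finset.sum_add_distrib]
    have h2 := hpn (n + 1)
    have h3 := hshift (n + 1)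
    rw [partialNumber] at h2
    gcongr
    linarith
  have h2 : ∑ K ∈ Finset.range (n + 1),
      ‖(√(K : ℝ) * √((K : ℝ) + 1) * r (K + 1) (K - 1) t : ℂ)‖ ≤ B + 1 := by
    -- The index is shifted since the term `K = 0`, with its truncated `K - 1`, vanishes by `√0 =
    -- 0`.
    have hterm : ∀ K, ‖(√((K + 1 : ℕ) : ℝ) * √(((K + 1 : ℕ) : ℝ) + 1) * r (K + 1 + 1) (K + 1 - 1) t : ℂ)‖
        ≤ ((K + 1 + 1) * (r (K + 1 + 1) (K + 1 + 1) t).re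
          + (K * (r K K t).re + 2 * (r K K t).re)) / 2 := by
      intro K
      have h3 := h.norm_le (K + 1 + 1) K ht
      have h4 : √((K + 1 : ℕ) : ℝ) * √(((K + 1 : ℕ) : ℝ) + 1) ≤ K + 1 + 1 := by
        rw [← Real.sqrt_mul (by positivity), Real.sqrt_le_left (by positivity)]
        push_cast
        nlinarith [(Nat.cast_nonneg K : (0 : ℝ) ≤ K)]
      rw [norm_mul, norm_mul, Complex.norm_real, Complex.norm_real,
        Real.norm_of_nonneg (Real.sqrt_nonneg _), Real.norm_of_nonneg (Real.sqrt_nonneg _),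
        Nat.add_sub_cancel]
      refine (mul_le_mul h4 h3 (norm_nonneg _) (by positivity)).trans (le_of_eq ?_)
      ring
    rw [Finset.sum_range_succ']
    refine (add_le_add (Finset.sum_le_sum fun K _ => hterm K) le_rfl).trans ?_
    rw [← Finset.sum_div, Finset.sum_add_distrib, Finset.sum_add_distrib, ← Finset.mul_sum]
    have h3 := hshift (n + 1)
    rw [Finset.sum_range_succ'] at h3
    have h4 := hpn n
    rw [partialNumber] at h4
    have h5 := h.sum_le_one (Finset.range n) ht
    have h6 := h.nonneg 1 t ht
    push_cast at h3 ⊢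
    simp only [Real.sqrt_zero, Complex.ofReal_zero, zero_mul, norm_zero]
    norm_num at h3
    linarith
  have h3 : ∑ K ∈ Finset.range (n + 1),
      ‖(((∑ j ∈ Finset.range K, (r j j t).re) - P : ℝ) : ℂ)‖ ≤ B + 1 := by
    have hterm : ∀ K ∈ Finset.range (n + 1),
        ‖(((∑ j ∈ Finset.range K, (r j j t).re) - P : ℝ) : ℂ)‖
          = P - ∑ j ∈ Finset.range K, (r j j t).re := by
      intro K _
      have := sum_le_hasSum (Finset.range K) (fun j _ => h.nonneg j t ht) hP
      rw [Complex.norm_real, Real.norm_of_nonpos (by linarith)]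
      ring
    -- The summed tails of the trace are the cut-off first moment at `n` plus one further `P`.
    rw [Finset.sum_congr rfl hterm, Finset.sum_range_succ', Finset.sum_sub_distrib, ← traceSum]
    have := (h.cut_le_number ht hP hN n).trans hB
    simp only [Finset.sum_const, Finset.card_range, nsmul_eq_mul, Finset.range_zero,
      Finset.sum_empty, sub_zero]
    linarith
  have h4 : ∑ K ∈ Finset.range (n + 1), ‖((K * (r K K t).re : ℝ) : ℂ)‖ ≤ B + 1 := by
    have := hpn (n + 1)
    rw [partialNumber] at this
    rw [Finset.sum_congr rfl fun K _ => by
      rw [Complex.norm_real, Real.norm_of_nonneg (h.number_term_nonneg ht K)]]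
    linarith
  have hterm : ∀ K ∈ Finset.range (n + 1), ‖amplitudeError g σ P r t K‖
      ≤ ‖(σ * (K * amplitudeTerm r K t) : ℂ)‖
        + |g| * (‖(√(K : ℝ) * √((K : ℝ) + 1) * r (K + 1) (K - 1) t : ℂ)‖
          + ‖(((∑ j ∈ Finset.range K, (r j j t).re) - P : ℝ) : ℂ)‖
          + ‖((K * (r K K t).re : ℝ) : ℂ)‖) := by
    intro K _
    refine (norm_sub_le _ _).trans ?_
    rw [norm_mul (Complex.I * g : ℂ), norm_mul Complex.I, Complex.norm_I, one_mul, Complex.norm_real,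
      Real.norm_eq_abs]
    gcongr
    exact (norm_sub_le _ _).trans (add_le_add (norm_add_le _ _) le_rfl)
  refine (norm_sum_le _ _).trans ((Finset.sum_le_sum hterm).trans ?_)
  rw [Finset.sum_add_distrib, ← Finset.mul_sum, Finset.sum_add_distrib, Finset.sum_add_distrib]
  have h5 : |g| * (3 * B + 3) ≤ √((n : ℝ) + 1) * (|g| * (3 * B + 3)) :=
    le_mul_of_one_le_left (by positivity) hsq
  have h6 := mul_le_mul_of_nonneg_left (add_le_add (add_le_add h2 h3) h4) (abs_nonneg g)
  rw [mul_add]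
  linarith

/-- The mean amplitude of the damped and driven mode solves `A' = -μ A - i g P`. -/
theorem amplitude_eq (h : IsDrivenMode ε g σ a b r) (hσ : 0 < σ)
    (hP : ∀ t ∈ Set.Icc a b, HasSum (fun j => (r j j t).re) P)
    (hN : ∀ t ∈ Set.Icc a b, Summable fun j : ℕ => (j : ℝ) * (r j j t).re)
    (hB : ∀ t ∈ Set.Icc a b, modeNumber r t ≤ B)
    {μ κ : ℂ} (hμ : μ = σ / 2 + Complex.I * ε) (hκ : μ * κ = Complex.I * g * P)
    {t : ℝ} (ht : t ∈ Set.Icc a b) :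
    amplitude r t = Complex.exp (-μ * (t - a)) * (amplitude r a + κ) - κ := by
  have hab : a ≤ b := ht.1.trans ht.2
  have ha : a ∈ Set.Icc a b := ⟨le_rfl, hab⟩
  have hB0 : 0 ≤ B := (tsum_nonneg (h.number_term_nonneg ha)).trans (hB a ha)
  set C : ℝ := σ * B + |g| * (3 * B + 3) with hC
  have hC0 : 0 ≤ C := by positivity
  set S : ℕ → ℝ → ℂ := fun K t => ∑ j ∈ Finset.range K, amplitudeTerm r j t with hS
  -- `-κ` is the stationary amplitude. The integrating factor `exp (μ (t - a))` removes the linear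
  -- part, so the derivative of the averaged sums is the averaged error alone.
  set G : ℕ → ℝ → ℂ := fun n t => Complex.exp (μ * (t - a)) *
    (((n : ℝ) + 1)⁻¹ • (∑ K ∈ Finset.range (n + 1), S K t) + κ) with hG
  set G' : ℕ → ℝ → ℂ := fun n t => Complex.exp (μ * (t - a)) *
    (((n : ℝ) + 1)⁻¹ • ∑ K ∈ Finset.range (n + 1), amplitudeError g σ P r t K) with hG'
  have hexp : ∀ t : ℝ, HasDerivAt (fun t : ℝ => Complex.exp (μ * (t - a)))
      (Complex.exp (μ * (t - a)) * μ) t := by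
    intro t
    have h1 : HasDerivAt (fun t : ℝ => μ * ((t : ℂ) - a)) μ t := by
      simpa using ((Complex.ofRealCLM.hasDerivAt (x := t)).sub_const (a : ℂ)).const_mul μ
    exact h1.cexp
  have hSc : ∀ K, ContinuousOn (S K) (Set.Icc a b) := fun K =>
    continuousOn_finsetSum _ fun j _ => continuousOn_const.mul (h.continuousOn _ _)
  have hGc : ∀ n, ContinuousOn (G n) (Set.Icc a b) := by
    intro n
    have h1 : ContinuousOn (fun t => ∑ K ∈ Finset.range (n + 1), S K t) (Set.Icc a b) :=
      continuousOn_finsetSum _ fun K _ => hSc K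
    exact (continuous_iff_continuousAt.2 fun t => (hexp t).continuousAt).continuousOn.mul
      ((h1.const_smul (((n : ℝ) + 1)⁻¹)).add continuousOn_const)
  have hGd : ∀ n, ∀ t ∈ Set.Ico a b, HasDerivWithinAt (G n) (G' n t) (Set.Ici t) t := by
    intro n t ht
    have ht' := Set.Ico_subset_Icc_self ht
    have h1 : ∀ K, HasDerivWithinAt (S K) (-μ * S K t - Complex.I * g * P
        + amplitudeError g σ P r t K) (Set.Ici t) t := by
      intro K
      rw [hμ, ← h.sum_amplitudeRate ht' P K]
      refine HasDerivWithinAt.fun_sum fun j _ => ?_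
      exact (h.hasDerivWithinAt (j + 1) j t ht).const_mul _ |>.congr_deriv (by rfl)
    have h2 := (hexp t).hasDerivWithinAt (s := Set.Ici t) |>.mul
      (((HasDerivWithinAt.fun_sum (u := Finset.range (n + 1)) fun K _ => h1 K).const_smul
        (((n : ℝ) + 1)⁻¹)).add_const κ)
    refine h2.congr_deriv ?_
    have hn : ((n : ℂ) + 1) ≠ 0 := by exact_mod_cast n.succ_ne_zero
    simp only [hG', Finset.sum_add_distrib, Finset.sum_sub_distrib, Finset.sum_const,
      Finset.card_range, nsmul_eq_mul, Complex.real_smul, ← Finset.mul_sum, Pi.smul_apply]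
    push_cast
    rw [← hκ]
    field_simp
    ring
  have hre : ∀ t : ℝ, ‖Complex.exp (μ * (t - a))‖ = Real.exp (σ / 2 * (t - a)) := by
    intro t
    rw [Complex.norm_exp, hμ]
    congr 1
    simp
  have hbound : ∀ n, ∀ s ∈ Set.Ico a b, ‖G' n s‖
      ≤ Real.exp (σ / 2 * (b - a)) * (C / √((n : ℝ) + 1)) := by
    intro n s hs
    have hs' := Set.Ico_subset_Icc_self hs
    rw [hG', norm_mul, hre, norm_smul, Real.norm_of_nonneg (by positivity)]
    have h1 := h.norm_amplitudeError_sum_le hσ hs' (hP s hs') (hN s hs') (hB s hs') n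
    have h2 : Real.exp (σ / 2 * (s - a)) ≤ Real.exp (σ / 2 * (b - a)) :=
      Real.exp_le_exp.2 (mul_le_mul_of_nonneg_left (by linarith [hs.2]) (by positivity))
    have h3 : C / √((n : ℝ) + 1) = ((n : ℝ) + 1)⁻¹ * (√((n : ℝ) + 1) * C) := by
      have h4 : √((n : ℝ) + 1) ^ 2 = n + 1 := Real.sq_sqrt (by positivity)
      have h5 : √((n : ℝ) + 1) ≠ 0 := by positivity
      field_simp
      rw [h4]
    rw [h3]
    gcongr
  have hGlim : ∀ s ∈ Set.Icc a b, Tendsto (fun n => G n s) atTop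
      (𝓝 (Complex.exp (μ * (s - a)) * (amplitude r s + κ))) := by
    intro s hs
    have h1 := (h.summable_norm_amplitudeTerm hs (hP s hs) (hN s hs)).of_norm.hasSum
    have h2 := h1.tendsto_sum_nat.cesaro_smul.comp (tendsto_add_atTop_nat 1)
    have h3 := (h2.add_const κ).const_mul (Complex.exp (μ * (s - a)))
    refine h3.congr fun n => ?_
    simp [hG, hS]
  have hzero : Tendsto (fun n : ℕ => Real.exp (σ / 2 * (b - a)) * (C / √((n : ℝ) + 1)) * (t - a))
      atTop (𝓝 0) := by
    have h1 : Tendsto (fun n : ℕ => √((n : ℝ) + 1)) atTop atTop :=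
      Real.tendsto_sqrt_atTop.comp (tendsto_atTop_add_const_right _ _ tendsto_natCast_atTop_atTop)
    simpa using ((h1.const_div_atTop C).const_mul (Real.exp (σ / 2 * (b - a)))).mul_const (t - a)
  -- The mean value inequality for right derivatives, in the limit `n → ∞`: the limit of `G n` has
  -- the same value at `t` and at `a`.
  have hle := le_of_tendsto_of_tendsto' ((hGlim t ht).sub (hGlim a ha)).norm hzero fun n =>
    norm_image_sub_le_of_norm_deriv_right_le_segment (hGc n) (hGd n) (hbound n) t ht
  have heq := sub_eq_zero.1 (norm_le_zero_iff.1 hle)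
  rw [sub_self, mul_zero, Complex.exp_zero, one_mul] at heq
  rw [← heq, ← mul_assoc, ← Complex.exp_add]
  simp

end IsDrivenMode


/-! ### Closed formulas for the passage of one atom -/

namespace IsDrivenMode

variable {ε g σ a b : ℝ} {r : ℕ → ℕ → ℝ → ℂ} {P : ℝ}

/-- The mean amplitude after the passage of an atom. -/
theorem amplitude_step (h : IsDrivenMode ε g σ a b r) (hab : a ≤ b) (hσ : 0 < σ)
    (hP : ∀ t ∈ Set.Icc a b, HasSum (fun j => (r j j t).re) P)
    (hNa : Summable fun j : ℕ => (j : ℝ) * (r j j a).re)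
    {μ z : ℂ} (hμ : μ = σ / 2 + Complex.I * ε) (hz : z = Complex.exp (-μ * (b - a))) :
    amplitude r b = z * amplitude r a - Complex.I * g * P / μ * (1 - z) := by
  have hμ0 : μ ≠ 0 := by
    rintro rfl
    have := congrArg Complex.re hμ
    simp at this
    linarith
  rw [h.amplitude_eq (κ := Complex.I * g * P / μ) hσ hP
    (fun t ht => (h.number_bounded hσ hP hNa ht).1)
    (fun t ht => (h.number_bounded hσ hP hNa ht).2) hμ (by field_simp) ⟨hab, le_rfl⟩, ← hz]
  ring

/-- The first moment after the passage of an atom. -/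
theorem number_step (h : IsDrivenMode ε g σ a b r) (hab : a ≤ b) (hσ : 0 < σ)
    (hP : ∀ t ∈ Set.Icc a b, HasSum (fun j => (r j j t).re) P)
    (hNa : Summable fun j : ℕ => (j : ℝ) * (r j j a).re)
    {μ z : ℂ} (hμ : μ = σ / 2 + Complex.I * ε) (hz : z = Complex.exp (-μ * (b - a)))
    {e : ℝ} (he : e = Real.exp (-σ * (b - a))) :
    modeNumber r b = e * modeNumber r a
      - 2 * g * (amplitude r a * ((z - e) / (starRingEnd ℂ) μ)).im
      + g ^ 2 * P / ‖μ‖ ^ 2 * (1 + e - 2 * z.re) := by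
  have hμ0 : μ ≠ 0 := by
    rintro rfl
    have := congrArg Complex.re hμ
    simp at this
    linarith
  have hμc : (starRingEnd ℂ) μ = σ - μ := by
    rw [hμ]
    simp only [map_add, map_div₀, map_mul, Complex.conj_ofReal, Complex.conj_I, map_ofNat]
    ring
  have hμc0 : (σ : ℂ) - μ ≠ 0 := by
    rw [← hμc]; simpa using hμ0
  have hσ0 : (σ : ℂ) ≠ 0 := by exact_mod_cast hσ.ne'
  have hN := fun t ht => (h.number_bounded hσ hP hNa (t := t) ht).1
  have hB := fun t ht => (h.number_bounded hσ hP hNa (t := t) ht).2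
  set κ : ℂ := Complex.I * g * P / μ with hκ
  set α : ℂ := amplitude r a with hα
  -- Duhamel's formula: `f` solves `f' = A - σ f` with `f a = 0`, where `A` is the explicit
  -- amplitude. The denominator `σ - μ` is the conjugate of `μ`, hence nonzero.
  set f : ℝ → ℂ := fun t => (α + κ) * ((Complex.exp (-μ * (t - a)) - Complex.exp (-σ * (t - a)))
    / (σ - μ)) - κ * (1 - Complex.exp (-σ * (t - a))) / σ with hf
  have hexp : ∀ (c : ℂ) (t : ℝ), HasDerivAt (fun t : ℝ => Complex.exp (c * (t - a)))
      (Complex.exp (c * (t - a)) * c) t := by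
    intro c t
    have h1 : HasDerivAt (fun t : ℝ => c * ((t : ℂ) - a)) c t := by
      simpa using ((Complex.ofRealCLM.hasDerivAt (x := t)).sub_const (a : ℂ)).const_mul c
    exact h1.cexp
  have hfd : ∀ t : ℝ, HasDerivAt f ((Complex.exp (-μ * (t - a)) * (α + κ) - κ) - σ * f t) t := by
    intro t
    have h1 := ((((hexp (-μ) t).sub (hexp (-σ) t)).div_const ((σ : ℂ) - μ)).const_mul (α + κ)).sub
      ((((hexp (-σ) t).const_sub 1).const_mul κ).div_const (σ : ℂ))
    refine h1.congr_deriv ?_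
    simp only [hf]
    field_simp
    ring
  have hYd : ∀ t : ℝ, HasDerivAt
      (fun t => Real.exp (-σ * (t - a)) * modeNumber r a - 2 * g * (f t).im)
      ((-2 * g * (Complex.exp (-μ * (t - a)) * (α + κ) - κ).im)
        - σ * (Real.exp (-σ * (t - a)) * modeNumber r a - 2 * g * (f t).im)) t := by
    intro t
    have h1 : HasDerivAt (fun t => Real.exp (-σ * (t - a))) (Real.exp (-σ * (t - a)) * -σ) t := by
      simpa using (((hasDerivAt_id t).sub_const a).const_mul (-σ)).exp
    have h2 := Complex.imCLM.hasFDerivAt.comp_hasDerivAt t (hfd t)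
    refine ((h1.mul_const (modeNumber r a)).sub (h2.const_mul (2 * g))).congr_deriv ?_
    rw [Complex.imCLM_apply, Complex.sub_im _ (σ * f t), Complex.im_ofReal_mul]
    ring
  have hmain := h.number_eq hab hσ hP hN hB
    (F := fun t => -2 * g * (Complex.exp (-μ * (t - a)) * (α + κ) - κ).im)
    (fun t ht => by
      rw [h.amplitude_eq (κ := κ) hσ hP hN hB hμ (by rw [hκ]; field_simp) ht])
    (by fun_prop) hYd (by simp [hf])
  have hec : Complex.exp (-σ * (b - a)) = e := by rw [he]; push_cast; rfl
  rw [hmain]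
  simp only [hf]
  rw [hec, ← hz, ← he, hμc]
  have hsplit : ((α + κ) * ((z - e) / (σ - μ)) - κ * (1 - e) / σ)
      = α * ((z - e) / (σ - μ)) + (κ * ((z - e) / (σ - μ)) - κ * (1 - e) / σ) := by ring
  -- With `|μ|² = μ (σ - μ)` the terms containing `κ` become real multiples of `i (z - e)` and `i (σ
  -- - μ)`, whose imaginary parts are explicit.
  have hnorm : ((‖μ‖ ^ 2 : ℝ) : ℂ) = μ * (σ - μ) := by
    rw [← hμc, Complex.mul_conj, Complex.normSq_eq_norm_sq]
  have h1 : κ * ((z - e) / (σ - μ))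
      = ((g * P / ‖μ‖ ^ 2 : ℝ) : ℂ) * (Complex.I * (z - e)) := by
    rw [Complex.ofReal_div, hnorm, hκ]
    push_cast
    field_simp
  have h2 : κ * (1 - e) / σ
      = ((g * P * (1 - e) / (σ * ‖μ‖ ^ 2) : ℝ) : ℂ) * (Complex.I * (σ - μ)) := by
    rw [Complex.ofReal_div, Complex.ofReal_mul σ, hnorm, hκ]
    push_cast
    field_simp
  have hre : μ.re = σ / 2 := by rw [hμ]; simp
  have hn0 : ‖μ‖ ≠ 0 := norm_ne_zero_iff.2 hμ0
  rw [hsplit, Complex.add_im, Complex.sub_im, h1, h2, Complex.im_ofReal_mul,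
    Complex.im_ofReal_mul]
  simp only [Complex.mul_im, Complex.I_re, Complex.I_im, Complex.sub_re, Complex.ofReal_re, hre,
    zero_mul, one_mul, zero_add]
  field_simp
  ring

end IsDrivenMode

end LeakyCavity

/-- The Cauchy–Schwarz inequality for the form of a positive operator. -/
theorem ContinuousLinearMap.IsPositive.norm_inner_sq_le {H : Type*} [NormedAddCommGroup H]
    [InnerProductSpace ℂ H] [CompleteSpace H] {T : H →L[ℂ] H} (hT : T.IsPositive) (x y : H) :
    ‖⟪x, T y⟫_ℂ‖ ^ 2 ≤ (⟪x, T x⟫_ℂ).re * (⟪y, T y⟫_ℂ).re := by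
  obtain ⟨S, rfl⟩ := CStarAlgebra.nonneg_iff_eq_star_mul_self.1
    ((ContinuousLinearMap.nonneg_iff_isPositive T).2 hT)
  have h : ∀ u v : H, ⟪u, (star S * S) v⟫_ℂ = ⟪S u, S v⟫_ℂ := fun u v =>
    ContinuousLinearMap.adjoint_inner_right S u (S v)
  have hn : ∀ u : H, (⟪S u, S u⟫_ℂ).re = ‖S u‖ ^ 2 := fun u => inner_self_eq_norm_sq (𝕜 := ℂ) _
  rw [h, h, h, hn, hn, ← mul_pow]
  exact pow_le_pow_left₀ (norm_nonneg _) (norm_inner_le_norm _ _) 2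

namespace LeakyCavity

/-! ### Matrix elements of the composite system -/

theorem inner_fock_left (j : ℕ) (x : Cavity) : ⟪fock j, x⟫_ℂ = x j := by
  rw [fock, lp.inner_single_left]
  simp

theorem toCavity_single (j : ℕ) (c : ℂ) :
    FinCavity.toCavity (Finsupp.single j c) = c • fock j := by
  simp [FinCavity.toCavity]

theorem annih_single (j : ℕ) (c : ℂ) :
    annih (Finsupp.single j c) = Finsupp.single (j - 1) (c * (√(j : ℝ) : ℝ)) := by
  simp [annih]

theorem creat_single (j : ℕ) (c : ℂ) :
    creat (Finsupp.single j c) = Finsupp.single (j + 1) (c * (√((j : ℝ) + 1) : ℝ)) := by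
  simp [creat]

theorem photonOp_single (j : ℕ) (c : ℂ) :
    photonOp (Finsupp.single j c) = Finsupp.single j (c * j) := by
  rw [photonOp, LinearMap.comp_apply, annih_single, creat_single]
  rcases j with _ | j
  · simp
  · rw [Nat.add_sub_cancel, mul_assoc, ← Complex.ofReal_mul]
    push_cast
    rw [← Complex.ofReal_mul, Real.mul_self_sqrt (by positivity)]
    push_cast; rfl

theorem component_embed {M : ℕ} (ω ω' : Beam M) (x : Cavity) :
    component ω (embed ω' x) = if ω = ω' then x else 0 := by
  by_cases h : ω = ω'
  · subst h; simp [component, embed]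
  · simp [component, embed, h]

theorem inner_embed_left {M : ℕ} (ω : Beam M) (x : Cavity) (v : System M) :
    ⟪embed ω x, v⟫_ℂ = ⟪x, component ω v⟫_ℂ := by
  rw [PiLp.inner_apply, Finset.sum_eq_single ω]
  · simp [component, embed]
  · intro ω' _ h
    simp [embed, h]
  · simp

theorem toSystem_single {M : ℕ} (ω : Beam M) (x : FinCavity) :
    FinSystem.toSystem (Pi.single ω x : FinSystem M) = embed ω x.toCavity := by
  ext ω' : 1
  by_cases h : ω' = ω
  · subst h; simp [FinSystem.toSystem, embed]
  · simp [FinSystem.toSystem, embed, h]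

theorem onCavity_single {M : ℕ} (B : FinCavity →ₗ[ℂ] FinCavity) (ω : Beam M) (x : FinCavity) :
    onCavity M B (Pi.single ω x) = Pi.single ω (B x) := by
  funext ω'
  by_cases h : ω' = ω
  · subst h; simp [onCavity]
  · simp [onCavity, h]

/-- The occupation number of the atom `k` in the configuration `ω`. -/
def occupation {M : ℕ} (ω : Beam M) (k : Fin M) : ℝ := if ω k = 1 then 1 else 0

theorem atomNumber_apply (a b : Fin 2) :
    atomNumber a b = if a = b ∧ b = 1 then 1 else 0 := by
  fin_cases a <;> fin_cases b <;> simp [atomNumber, atomAnnih, Matrix.mul_apply]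

theorem onBeam_atomNumber_single {M : ℕ} (k : Fin M) (ω : Beam M) (x : FinCavity) :
    onBeam (onAtom k atomNumber) (Pi.single ω x) = Pi.single ω ((occupation ω k : ℂ) • x) := by
  funext ω'
  have h1 : onBeam (onAtom k atomNumber) (Pi.single ω x) ω'
      = onAtom k atomNumber ω' ω • x := by
    simp only [onBeam, LinearMap.pi_apply, LinearMap.sum_apply, LinearMap.smul_apply,
      LinearMap.proj_apply]
    rw [Finset.sum_eq_single ω]
    · simp
    · intro ω'' _ h; simp [h]
    · simp
  rw [h1]
  by_cases h : ω' = ω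
  · subst h
    simp [onAtom, atomNumber_apply, occupation]
  · rw [Pi.single_eq_of_ne h]
    have : onAtom k atomNumber ω' ω = 0 := by
      simp only [onAtom, Matrix.of_apply, atomNumber_apply]
      split_ifs with h2 h3
      · exact absurd (funext fun j => by
          by_cases hj : j = k
          · rw [hj]; exact h3.1
          · exact h2 j hj) h
      · rfl
      · rfl
    rw [this, zero_smul]

/-- The passage intervals are disjoint, so only atom `k` interacts at time `t`, and the atomic
number operators are diagonal: the configuration is preserved. -/
theorem hamiltonian_single {ε E g τ : ℝ} {M : ℕ} (hτ : 0 < τ) (k : Fin M) {t : ℝ}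
    (ht : t ∈ Set.Ico ((k : ℝ) * τ) (((k : ℝ) + 1) * τ)) (ω : Beam M) (x : FinCavity) :
    hamiltonian ε E g τ M t (Pi.single ω x) =
      Pi.single ω ((ε : ℂ) • photonOp x + ((E * ∑ i, occupation ω i : ℝ) : ℂ) • x
        + ((g * occupation ω k : ℝ) : ℂ) • (creat x + annih x)) := by
  have hind : ∀ i : Fin M,
      (Set.Ico ((i : ℝ) * τ) (((i : ℝ) + 1) * τ)).indicator (fun _ => (g : ℂ)) t
        = if i = k then (g : ℂ) else 0 := by
    intro i
    split_ifs with h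
    · subst h; exact Set.indicator_of_mem ht _
    · refine Set.indicator_of_notMem (fun hi => h ?_) _
      have h1 : (i : ℝ) < k + 1 := lt_of_mul_lt_mul_right (hi.1.trans_lt ht.2) hτ.le
      have h2 : (k : ℝ) < i + 1 := lt_of_mul_lt_mul_right (ht.1.trans_lt hi.2) hτ.le
      have h1' : (i : ℕ) < k + 1 := by exact_mod_cast h1
      have h2' : (k : ℕ) < i + 1 := by exact_mod_cast h2
      exact Fin.ext (by omega)
  have hsum : (∑ i : Fin M,
        (Set.Ico ((i : ℝ) * τ) (((i : ℝ) + 1) * τ)).indicator (fun _ => (g : ℂ)) t •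
          (onCavity M (creat + annih) ∘ₗ onBeam (onAtom i atomNumber)))
      = (g : ℂ) • (onCavity M (creat + annih) ∘ₗ onBeam (onAtom k atomNumber)) := by
    rw [Finset.sum_eq_single k]
    · rw [hind, if_pos rfl]
    · intro i _ h; rw [hind, if_neg h, zero_smul]
    · simp
  rw [hamiltonian, hsum]
  simp only [LinearMap.add_apply, LinearMap.smul_apply, LinearMap.sum_apply, LinearMap.comp_apply,
    onCavity_single, onBeam_atomNumber_single, map_smul]
  funext ω'
  by_cases h : ω' = ω
  · subst h
    simp only [Pi.add_apply, Pi.smul_apply, Finset.sum_apply, Pi.single_eq_same, ← Finset.smul_sum,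
      ← Finset.sum_smul, smul_smul]
    push_cast
    module
  · simp [h]


/-! ### Diagonal blocks of the state at fixed configurations -/

/-- The matrix elements of the diagonal block of the state at the configuration `ω`. -/
def block {M : ℕ} (ρ : ℝ → System M →L[ℂ] System M) (ω : Beam M) (j k : ℕ) (t : ℝ) : ℂ :=
  ⟪embed ω (fock j), ρ t (embed ω (fock k))⟫_ℂ

/-- The probability of the configuration `ω` in the product state. -/
def beamWeight {M : ℕ} (η : Matrix (Fin 2) (Fin 2) ℂ) (ω : Beam M) : ℝ := ∏ k, (η (ω k) (ω k)).re

theorem toSystem_single_single {M : ℕ} (ω : Beam M) (j : ℕ) :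
    FinSystem.toSystem (Pi.single ω (Finsupp.single j 1) : FinSystem M) = embed ω (fock j) := by
  rw [toSystem_single, toCavity_single, one_smul]

theorem hamiltonian_toSystem {ε E g τ : ℝ} {M : ℕ} (hτ : 0 < τ) (k : Fin M) {t : ℝ}
    (ht : t ∈ Set.Ico ((k : ℝ) * τ) (((k : ℝ) + 1) * τ)) (ω : Beam M) (j : ℕ) :
    (hamiltonian ε E g τ M t (Pi.single ω (Finsupp.single j 1))).toSystem =
      ((ε * j + E * ∑ i, occupation ω i : ℝ) : ℂ) • embed ω (fock j)
        + ((g * occupation ω k * √((j : ℝ) + 1) : ℝ) : ℂ) • embed ω (fock (j + 1))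
        + ((g * occupation ω k * √(j : ℝ) : ℝ) : ℂ) • embed ω (fock (j - 1)) := by
  rw [hamiltonian_single hτ k ht, toSystem_single, photonOp_single, creat_single, annih_single]
  simp only [map_add, map_smul, toCavity_single, smul_smul]
  push_cast
  module

/-- With the same configuration on both sides the atomic energy is one real scalar and cancels in
the commutator. -/
theorem lindbladForm_block {ε E g σ τ : ℝ} {M : ℕ} (hτ : 0 < τ) (i : Fin M) {t : ℝ}
    (ht : t ∈ Set.Ico ((i : ℝ) * τ) (((i : ℝ) + 1) * τ)) (ω : Beam M)
    (ρ : ℝ → System M →L[ℂ] System M) (j k : ℕ) :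
    lindbladForm (hamiltonian ε E g τ M t) σ (ρ t) (Pi.single ω (Finsupp.single j 1))
        (Pi.single ω (Finsupp.single k 1))
      = modeRate ε (g * occupation ω i) σ (fun j k => block ρ ω j k t) j k := by
  simp only [lindbladForm, hamiltonian_toSystem hτ i ht, onCavity_single, toSystem_single,
    photonOp_single, creat_single, toCavity_single, map_add, map_smul, inner_add_left,
    inner_add_right, inner_smul_left, inner_smul_right, modeRate, block, Complex.conj_ofReal,
    one_mul, one_smul, Complex.conj_natCast]
  push_cast
  ring

namespace IsSystemState

variable {M : ℕ} {ρ : System M →L[ℂ] System M}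

theorem hasSum_re (h : IsSystemState ρ) :
    HasSum (fun i : Beam M × ℕ => (⟪embed i.1 (fock i.2), ρ (embed i.1 (fock i.2))⟫_ℂ).re) 1 := by
  simpa using Complex.hasSum_re h.2

theorem re_nonneg (h : IsSystemState ρ) (x : System M) : 0 ≤ (⟪x, ρ x⟫_ℂ).re :=
  h.1.re_inner_nonneg_right x

theorem summable_block (h : IsSystemState ρ) (ω : Beam M) :
    Summable fun j => (⟪embed ω (fock j), ρ (embed ω (fock j))⟫_ℂ).re :=
  h.hasSum_re.summable.prod_factor ω

theorem sum_tsum_block (h : IsSystemState ρ) :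
    ∑ ω, ∑' j, (⟪embed ω (fock j), ρ (embed ω (fock j))⟫_ℂ).re = 1 := by
  have h1 := h.hasSum_re.prod_fiberwise fun ω => (h.summable_block ω).hasSum
  exact (hasSum_fintype _).unique h1

theorem tsum_block_le_one (h : IsSystemState ρ) (ω : Beam M) :
    ∑' j, (⟪embed ω (fock j), ρ (embed ω (fock j))⟫_ℂ).re ≤ 1 := by
  rw [← h.sum_tsum_block]
  exact Finset.single_le_sum
    (f := fun ω => ∑' j, (⟪embed ω (fock j), ρ (embed ω (fock j))⟫_ℂ).re)
    (fun ω _ => tsum_nonneg fun j => h.re_nonneg _) (Finset.mem_univ ω)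

end IsSystemState

theorem photonTerm_traceAtoms {M : ℕ} (ρ : ℝ → System M →L[ℂ] System M) (t : ℝ) (m : ℕ) :
    photonTerm (traceAtoms (ρ t)) m = ∑ ω, (m : ℝ) * (block ρ ω m m t).re := by
  simp only [photonTerm, photonOp_single, toCavity_single, inner_smul_left, traceAtoms,
    _root_.sum_apply, ContinuousLinearMap.comp_apply, inner_sum, block,
    inner_embed_left, one_mul, Complex.conj_ofReal, ← Complex.ofReal_natCast,
    Complex.re_ofReal_mul, Complex.re_sum]

theorem photonTerm_eq (ρ : Cavity →L[ℂ] Cavity) (m : ℕ) :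
    photonTerm ρ m = m * (⟪fock m, ρ (fock m)⟫_ℂ).re := by
  simp only [photonTerm, photonOp_single, toCavity_single, inner_smul_left, one_mul,
    Complex.conj_ofReal, ← Complex.ofReal_natCast, Complex.re_ofReal_mul]

theorem photonNumber_traceAtoms {M : ℕ} {ρ : ℝ → System M →L[ℂ] System M} {t : ℝ}
    (h : ∀ ω, Summable fun j : ℕ => (j : ℝ) * (block ρ ω j j t).re) :
    FinitePhotonNumber (traceAtoms (ρ t)) ∧
      photonNumber (traceAtoms (ρ t)) = ∑ ω, modeNumber (block ρ ω) t := by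
  have h1 := hasSum_sum (s := Finset.univ) fun ω _ => (h ω).hasSum
  simp_rw [← photonTerm_traceAtoms] at h1
  exact ⟨h1.summable, h1.tsum_eq⟩

theorem IsGaugeInvariant.inner_fock_succ {ρ : Cavity →L[ℂ] Cavity} (h : IsGaugeInvariant ρ)
    (j : ℕ) : ⟪fock (j + 1), ρ (fock j)⟫_ℂ = 0 := by
  have hphase : ∀ (α : ℝ) (x : Cavity) (m : ℕ),
      phase α x m = Complex.exp (((α * m : ℝ) : ℂ) * Complex.I) * x m := fun _ _ _ => rfl
  have hfock : phase (-Real.pi) (fock j)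
      = Complex.exp (((-Real.pi * j : ℝ) : ℂ) * Complex.I) • fock j := by
    ext m
    rw [hphase, lp.coeFn_smul, Pi.smul_apply, smul_eq_mul]
    by_cases hm : m = j
    · rw [hm]
    · simp [fock, hm]
  -- The angle `π` suffices: it multiplies this matrix element by `-1`, so the element equals its
  -- own negative.
  have h1 := congrArg (fun T : Cavity →L[ℂ] Cavity => T (fock j) (j + 1)) (h Real.pi)
  simp only [ContinuousLinearMap.comp_apply] at h1
  rw [hphase, hfock, map_smul, lp.coeFn_smul, Pi.smul_apply, smul_eq_mul, ← mul_assoc,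
    ← Complex.exp_add] at h1
  have h2 : ((Real.pi * (j + 1 : ℕ) : ℝ) : ℂ) * Complex.I + ((-Real.pi * j : ℝ) : ℂ) * Complex.I
      = Real.pi * Complex.I := by
    push_cast; ring
  rw [h2, Complex.exp_pi_mul_I] at h1
  rw [inner_fock_left]
  linear_combination -h1 / 2

theorem component_tensorOp_embed {M : ℕ} (ρ : Cavity →L[ℂ] Cavity)
    (A : Matrix (Beam M) (Beam M) ℂ) (ω : Beam M) (x : Cavity) :
    component ω (tensorOp ρ A (embed ω x)) = A ω ω • ρ x := by
  simp only [tensorOp, _root_.sum_apply, _root_.smul_apply,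
    ContinuousLinearMap.comp_apply, map_sum, map_smul, component_embed]
  rw [Finset.sum_eq_single ω]
  · rw [Finset.sum_eq_single ω]
    · simp
    · intro ω' _ h; simp [h]
    · simp
  · intro ω' _ h; simp [h.symm]
  · simp

theorem beamState_diag {M : ℕ} {η : Matrix (Fin 2) (Fin 2) ℂ} (hη : IsAtomState η) (ω : Beam M) :
    beamState M η ω ω = (beamWeight η ω : ℂ) := by
  rw [beamState, Matrix.of_apply, beamWeight, Complex.ofReal_prod]
  refine Finset.prod_congr rfl fun k _ => ?_
  have h1 := congrFun (congrFun hη.1.1 (ω k)) (ω k)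
  rw [Matrix.conjTranspose_apply] at h1
  exact (Complex.conj_eq_iff_re.1 h1).symm

/-! ### Each block is a driven mode with conserved weight -/

namespace IsEvolution

variable {ε E g σ τ : ℝ} {ρC : Cavity →L[ℂ] Cavity} {η : Matrix (Fin 2) (Fin 2) ℂ} {M : ℕ}
  {ρ : ℝ → System M →L[ℂ] System M}

/-- Positivity of the full state gives symmetry, nonnegativity and Cauchy–Schwarz for its blocks;
the trace of a block is one of the nonnegative summands of the total trace one. -/
theorem isDrivenMode (h : IsEvolution ε E g σ τ ρC η M ρ) (hτ : 0 < τ) (ω : Beam M) (i : Fin M) :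
    IsDrivenMode ε (g * occupation ω i) σ (i * τ) ((i + 1) * τ) (block ρ ω) := by
  have hsub : Set.Icc ((i : ℝ) * τ) ((i + 1) * τ) ⊆ Set.Icc 0 (M * τ) := by
    have h1 : ((i : ℝ) + 1) ≤ M := by exact_mod_cast i.2
    exact Set.Icc_subset_Icc (by positivity) (by gcongr)
  have hsub' : Set.Ico ((i : ℝ) * τ) ((i + 1) * τ) ⊆ Set.Ico 0 (M * τ) := by
    have h1 : ((i : ℝ) + 1) ≤ M := by exact_mod_cast i.2
    exact Set.Ico_subset_Ico (by positivity) (by gcongr)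
  refine ⟨fun j k => ?_, fun j k t ht => ?_, fun j k t ht => ?_, fun j t ht => ?_,
    fun j k t ht => ?_, fun t ht => ?_, fun t ht => ?_⟩
  · have h1 := (h.continuousOn (Pi.single ω (Finsupp.single j 1))
      (Pi.single ω (Finsupp.single k 1))).mono hsub
    simp only [toSystem_single_single] at h1
    exact h1
  · have h1 := h.hasDerivWithinAt (Pi.single ω (Finsupp.single j 1))
      (Pi.single ω (Finsupp.single k 1)) t (hsub' ht)
    rw [lindbladForm_block hτ i ht] at h1
    simp only [toSystem_single_single] at h1
    exact h1
  · rw [block, block, inner_conj_symm]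
    exact (h.isState t (hsub ht)).1.inner_left_eq_inner_right _ _
  · exact (h.isState t (hsub ht)).re_nonneg _
  · exact (h.isState t (hsub ht)).1.norm_inner_sq_le _ _
  · exact (h.isState t (hsub ht)).summable_block ω
  · exact (h.isState t (hsub ht)).tsum_block_le_one ω

theorem block_zero (h : IsEvolution ε E g σ τ ρC η M ρ) (hη : IsAtomState η) (ω : Beam M)
    (j k : ℕ) : block ρ ω j k 0 = beamWeight η ω * ⟪fock j, ρC (fock k)⟫_ℂ := by
  rw [block, h.initial, inner_embed_left, component_tensorOp_embed, inner_smul_right,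
    beamState_diag hη]

theorem grid_mem (hτ : 0 < τ) {n : ℕ} (hn : n ≤ M) :
    (n : ℝ) * τ ∈ Set.Icc 0 (M * τ) :=
  ⟨by positivity, mul_le_mul_of_nonneg_right (by exact_mod_cast hn) hτ.le⟩

/-- The weight of each configuration of the atoms is conserved. -/
theorem tsum_block_eq (h : IsEvolution ε E g σ τ ρC η M ρ) (hσ : 0 < σ) (hτ : 0 < τ)
    (i : Fin M) (ω : Beam M) {t : ℝ} (ht : t ∈ Set.Icc ((i : ℝ) * τ) ((i + 1) * τ)) :
    ∑' j, (block ρ ω j j (i * τ)).re = ∑' j, (block ρ ω j j t).re := by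
  have h1 : ((i : ℝ) + 1) ≤ M := by exact_mod_cast i.2
  have htM : t ∈ Set.Icc 0 (M * τ) :=
    Set.Icc_subset_Icc (by positivity) (by gcongr) ht
  have h2 := (h.isState _ (grid_mem hτ i.2.le)).sum_tsum_block
  have h3 := (h.isState t htM).sum_tsum_block
  -- No block loses trace, and the total is one at both times, so no block can gain any.
  exact (Finset.sum_eq_sum_iff_of_le fun ω _ => (h.isDrivenMode hτ ω i).tsum_le_tsum hσ ht).1
    (h2.trans h3.symm) ω (Finset.mem_univ ω)

theorem tsum_block_grid (h : IsEvolution ε E g σ τ ρC η M ρ) (hρC : IsCavityState ρC)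
    (hη : IsAtomState η) (hσ : 0 < σ) (hτ : 0 < τ) (ω : Beam M) (n : ℕ) (hn : n ≤ M) :
    ∑' j, (block ρ ω j j (n * τ)).re = beamWeight η ω := by
  induction n with
  | zero =>
    have h1 := (Complex.hasSum_re hρC.2).mul_left (beamWeight η ω)
    simp only [Nat.cast_zero, zero_mul, h.block_zero hη, Complex.re_ofReal_mul]
    simpa using h1.tsum_eq
  | succ n ih =>
    rw [← ih (by omega)]
    have := h.tsum_block_eq hσ hτ ⟨n, hn⟩ ω (t := (n + 1) * τ)
      ⟨mul_le_mul_of_nonneg_right (by simp) hτ.le, le_rfl⟩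
    push_cast
    exact this.symm

theorem hasSum_block (h : IsEvolution ε E g σ τ ρC η M ρ) (hρC : IsCavityState ρC)
    (hη : IsAtomState η) (hσ : 0 < σ) (hτ : 0 < τ) (i : Fin M) (ω : Beam M) {t : ℝ}
    (ht : t ∈ Set.Icc ((i : ℝ) * τ) ((i + 1) * τ)) :
    HasSum (fun j => (block ρ ω j j t).re) (beamWeight η ω) := by
  rw [← h.tsum_block_grid hρC hη hσ hτ ω i i.2.le, h.tsum_block_eq hσ hτ i ω ht]
  exact ((h.isDrivenMode hτ ω i).summable t ht).hasSum

theorem hasSum_number_zero (h : IsEvolution ε E g σ τ ρC η M ρ) (hη : IsAtomState η)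
    (hfin : FinitePhotonNumber ρC) (ω : Beam M) :
    HasSum (fun j : ℕ => (j : ℝ) * (block ρ ω j j 0).re) (beamWeight η ω * photonNumber ρC) := by
  have h0 : HasSum (photonTerm ρC) (photonNumber ρC) := hfin.hasSum
  have h1 := h0.mul_left (beamWeight η ω)
  simp_rw [photonTerm_eq] at h1
  simp_rw [h.block_zero hη, Complex.re_ofReal_mul, mul_left_comm _ (beamWeight η ω)]
  exact h1

theorem amplitude_zero (h : IsEvolution ε E g σ τ ρC η M ρ) (hη : IsAtomState η)
    (hgauge : IsGaugeInvariant ρC) (ω : Beam M) : amplitude (block ρ ω) 0 = 0 := by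
  simp [amplitude, amplitudeTerm, h.block_zero hη, hgauge.inner_fock_succ]

theorem summable_number (h : IsEvolution ε E g σ τ ρC η M ρ) (hρC : IsCavityState ρC)
    (hη : IsAtomState η) (hfin : FinitePhotonNumber ρC) (hσ : 0 < σ) (hτ : 0 < τ) (ω : Beam M)
    (n : ℕ) (hn : n ≤ M) :
    Summable fun j : ℕ => (j : ℝ) * (block ρ ω j j (n * τ)).re := by
  induction n with
  | zero => simpa using (h.hasSum_number_zero hη hfin ω).summable
  | succ n ih =>
    have := ((h.isDrivenMode hτ ω ⟨n, hn⟩).number_bounded hσ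
      (fun t ht => h.hasSum_block hρC hη hσ hτ ⟨n, hn⟩ ω ht) (ih (by omega))
      (t := (n + 1) * τ) ⟨mul_le_mul_of_nonneg_right (by simp) hτ.le, le_rfl⟩).1
    push_cast
    exact this

end IsEvolution


/-! ### Expectations in the product state of the beam -/

theorem excitationProb_eq {η : Matrix (Fin 2) (Fin 2) ℂ} :
    (η 1 1).re = excitationProb η := by
  simp [excitationProb, Matrix.trace, Fin.sum_univ_two, Matrix.mul_apply, atomNumber_apply]

theorem IsAtomState.diag_sum {η : Matrix (Fin 2) (Fin 2) ℂ} (hη : IsAtomState η) :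
    (η 0 0).re + (η 1 1).re = 1 := by
  have h := congrArg Complex.re hη.2.1
  simpa [Matrix.trace, Fin.sum_univ_two] using h

theorem occupation_eq_prod {M : ℕ} (ω : Beam M) (k : Fin M) :
    occupation ω k = ∏ i, if i = k then (if ω i = 1 then 1 else 0 : ℝ) else 1 := by
  rw [Finset.prod_ite_eq' Finset.univ k fun i => (if ω i = 1 then 1 else 0 : ℝ)]
  simp [occupation]

/-- Independence of the atoms: the sum of a product over configurations factorizes. -/
theorem sum_prod_beam {M : ℕ} (F : Fin M → Fin 2 → ℝ) :
    ∑ ω : Beam M, ∏ i, F i (ω i) = ∏ i, (F i 0 + F i 1) := by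
  have := Finset.prod_univ_sum (fun _ : Fin M => (Finset.univ : Finset (Fin 2))) F
  rw [Fintype.piFinset_univ] at this
  simp_rw [Fin.sum_univ_two] at this
  exact this.symm

theorem sum_beamWeight {M : ℕ} {η : Matrix (Fin 2) (Fin 2) ℂ} (hη : IsAtomState η) :
    ∑ ω : Beam M, beamWeight η ω = 1 := by
  simp only [beamWeight]
  rw [sum_prod_beam fun _ x => (η x x).re]
  simp [hη.diag_sum]

theorem sum_beamWeight_occupation {M : ℕ} {η : Matrix (Fin 2) (Fin 2) ℂ} (hη : IsAtomState η)
    (k : Fin M) : ∑ ω : Beam M, occupation ω k * beamWeight η ω = excitationProb η := by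
  simp only [beamWeight, occupation_eq_prod, ← Finset.prod_mul_distrib]
  rw [sum_prod_beam fun i x =>
    (if i = k then (if x = 1 then 1 else 0 : ℝ) else 1) * (η x x).re]
  rw [Finset.prod_eq_single k]
  · simp [excitationProb_eq]
  · intro i _ h; simp [h, hη.diag_sum]
  · simp

theorem sum_beamWeight_occupation_mul {M : ℕ} {η : Matrix (Fin 2) (Fin 2) ℂ}
    (hη : IsAtomState η) {j k : Fin M} (hjk : j ≠ k) :
    ∑ ω : Beam M, occupation ω j * (occupation ω k * beamWeight η ω) = excitationProb η ^ 2 := by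
  simp only [beamWeight, occupation_eq_prod, ← Finset.prod_mul_distrib]
  rw [sum_prod_beam fun i x => (if i = j then (if x = 1 then 1 else 0 : ℝ) else 1) *
    ((if i = k then (if x = 1 then 1 else 0 : ℝ) else 1) * (η x x).re)]
  rw [Finset.prod_eq_mul j k hjk]
  · simp [hjk, hjk.symm, excitationProb_eq, sq]
  · intro i _ h; simp [h.1, h.2, hη.diag_sum]
  · simp
  · simp

theorem occupation_sq {M : ℕ} (ω : Beam M) (k : Fin M) :
    occupation ω k ^ 2 = occupation ω k := by
  unfold occupation; split_ifs <;> simp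

/-! ### The photon number after each passage -/

/-- The photon number after `n` passages in terms of `e = exp (-σ τ)`, `z = exp (-μ τ)` and
`G = g² / |μ|²`. -/
def numberFormula (G p e : ℝ) (z : ℂ) (N₀ : ℝ) (n : ℕ) : ℝ :=
  e ^ n * N₀ + p * G * (1 + e - 2 * z.re) * ((1 - e ^ n) / (1 - e))
    - p ^ 2 * (2 * G) * (1 - z.re) * ((1 - e ^ n) / (1 - e))
    + p ^ 2 * (2 * G) * (1 - (z ^ n).re)

/-- This is the form of the recursion that summing `number_step` over all configurations produces.
The term with `p ^ 2` stems from the amplitude left by earlier atoms, the term with `p` from the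
passing atom alone. -/
theorem numberFormula_succ {G p e : ℝ} {z : ℂ} {N₀ : ℝ} (he : e ≠ 1) (n : ℕ) :
    numberFormula G p e z N₀ (n + 1) = e * numberFormula G p e z N₀ n
      + 2 * G * p ^ 2 * ((1 - z ^ n) * (z - e)).re + G * p * (1 + e - 2 * z.re) := by
  have h1 : ((1 - z ^ n) * (z - e)).re = z.re - e - (z ^ (n + 1)).re + e * (z ^ n).re := by
    rw [show (1 - z ^ n) * (z - e) = z - e - z ^ (n + 1) + e * z ^ n by ring]
    simp only [Complex.add_re, Complex.sub_re, Complex.ofReal_re, Complex.re_ofReal_mul]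
  have he' : 1 - e ≠ 0 := sub_ne_zero.2 he.symm
  rw [h1]
  simp only [numberFormula]
  field_simp
  ring

theorem tendsto_numberFormula {G p e : ℝ} {z : ℂ} {N₀ : ℝ} (he0 : 0 ≤ e) (he1 : e < 1)
    (hz : ‖z‖ < 1) :
    Tendsto (numberFormula G p e z N₀) atTop
      (𝓝 (G * (p / (1 - e)) * (1 + e * (1 - 2 * p) - 2 * (1 - p) * z.re))) := by
  have h1 := tendsto_pow_atTop_nhds_zero_of_lt_one he0 he1
  have h2 := (Complex.continuous_re.tendsto 0).comp (tendsto_pow_atTop_nhds_zero_of_norm_lt_one hz)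
  have h3 := (((h1.mul_const N₀).add (((h1.const_sub 1).div_const (1 - e)).const_mul
    (p * G * (1 + e - 2 * z.re)))).sub (((h1.const_sub 1).div_const (1 - e)).const_mul
    (p ^ 2 * (2 * G) * (1 - z.re)))).add ((h2.const_sub 1).const_mul (p ^ 2 * (2 * G)))
  have he' : 1 - e ≠ 0 := by linarith
  refine h3.trans (le_of_eq ?_)
  rw [Complex.zero_re]
  congr 1
  field_simp
  ring

namespace IsEvolution

variable {ε E g σ τ : ℝ} {ρC : Cavity →L[ℂ] Cavity} {η : Matrix (Fin 2) (Fin 2) ℂ} {M : ℕ}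
  {ρ : ℝ → System M →L[ℂ] System M} {μ z : ℂ}

/-- The correlation of the cavity amplitude with an atom that has not passed yet. -/
theorem sum_occupation_amplitude (h : IsEvolution ε E g σ τ ρC η M ρ) (hρC : IsCavityState ρC)
    (hgauge : IsGaugeInvariant ρC) (hη : IsAtomState η) (hfin : FinitePhotonNumber ρC)
    (hσ : 0 < σ) (hτ : 0 < τ) (hμ : μ = σ / 2 + Complex.I * ε) (hz : z = Complex.exp (-μ * τ))
    (n : ℕ) (j : Fin M) (hj : n ≤ j) :
    ∑ ω, (occupation ω j : ℂ) * amplitude (block ρ ω) (n * τ)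
      = -(Complex.I * g * excitationProb η ^ 2 / μ) * (1 - z ^ n) := by
  induction n with
  | zero => simp [h.amplitude_zero hη hgauge]
  | succ n ih =>
    have hn : n < M := by omega
    have hle : (n : ℝ) * τ ≤ ((n : ℝ) + 1) * τ := mul_le_mul_of_nonneg_right (by simp) hτ.le
    have hstep : ∀ ω, amplitude (block ρ ω) ((n + 1 : ℕ) * τ)
        = z * amplitude (block ρ ω) (n * τ) - Complex.I * g / μ * (1 - z)
          * ((occupation ω ⟨n, hn⟩ * beamWeight η ω : ℝ) : ℂ) := by
      intro ω
      have := (h.isDrivenMode hτ ω ⟨n, hn⟩).amplitude_step hle hσ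
        (fun t ht => h.hasSum_block hρC hη hσ hτ ⟨n, hn⟩ ω ht)
        (h.summable_number hρC hη hfin hσ hτ ω n hn.le) hμ (z := z)
        (by rw [hz]; congr 2; push_cast; ring)
      push_cast at this ⊢
      rw [this]
      ring
    -- Atom `j` is still to come while atom `n` passes, so their joint excitation probability is `p
    -- ^ 2`, not `p`.
    have hjn : j ≠ ⟨n, hn⟩ := fun hc => by
      rw [hc] at hj
      exact absurd hj (by simp)
    have hcorr := congrArg (fun x : ℝ => (x : ℂ)) (sum_beamWeight_occupation_mul hη hjn)
    simp only [Complex.ofReal_sum] at hcorr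
    have hterm : ∀ ω, (occupation ω j : ℂ) * amplitude (block ρ ω) ((n + 1 : ℕ) * τ)
        = z * ((occupation ω j : ℂ) * amplitude (block ρ ω) (n * τ))
          - Complex.I * g / μ * (1 - z)
            * ((occupation ω j * (occupation ω ⟨n, hn⟩ * beamWeight η ω) : ℝ) : ℂ) := by
      intro ω
      rw [hstep]
      push_cast
      ring
    rw [Finset.sum_congr rfl fun ω _ => hterm ω, Finset.sum_sub_distrib, ← Finset.mul_sum,
      ← Finset.mul_sum, ih (by omega), hcorr]
    push_cast
    ring

theorem sum_modeNumber (h : IsEvolution ε E g σ τ ρC η M ρ) (hρC : IsCavityState ρC)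
    (hgauge : IsGaugeInvariant ρC) (hη : IsAtomState η) (hfin : FinitePhotonNumber ρC)
    (hσ : 0 < σ) (hτ : 0 < τ) (hμ : μ = σ / 2 + Complex.I * ε) (hz : z = Complex.exp (-μ * τ))
    (n : ℕ) (hn : n ≤ M) :
    ∑ ω, modeNumber (block ρ ω) (n * τ) = numberFormula (g ^ 2 / ‖μ‖ ^ 2) (excitationProb η)
      (Real.exp (-σ * τ)) z (photonNumber ρC) n := by
  induction n with
  | zero =>
    have h1 : ∀ ω, modeNumber (block ρ ω) 0 = beamWeight η ω * photonNumber ρC := fun ω =>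
      (h.hasSum_number_zero hη hfin ω).tsum_eq
    simp [numberFormula, h1, ← Finset.sum_mul, sum_beamWeight hη]
  | succ n ih =>
    set e := Real.exp (-σ * τ) with he
    have he1 : e ≠ 1 := by
      rw [he, Ne, Real.exp_eq_one_iff]
      nlinarith [mul_pos hσ hτ]
    have hle : (n : ℝ) * τ ≤ ((n : ℝ) + 1) * τ := mul_le_mul_of_nonneg_right (by simp) hτ.le
    -- The driving strength is `g` times an occupation that is `0` or `1`, so its square is `g ^ 2`
    -- times the same occupation.
    have hstep : ∀ ω, modeNumber (block ρ ω) ((n + 1 : ℕ) * τ)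
        = e * modeNumber (block ρ ω) (n * τ)
          - 2 * g * (((occupation ω ⟨n, hn⟩ : ℂ) * amplitude (block ρ ω) (n * τ))
            * ((z - e) / (starRingEnd ℂ) μ)).im
          + g ^ 2 / ‖μ‖ ^ 2 * (1 + e - 2 * z.re) * (occupation ω ⟨n, hn⟩ * beamWeight η ω) := by
      intro ω
      have := (h.isDrivenMode hτ ω ⟨n, hn⟩).number_step hle hσ
        (fun t ht => h.hasSum_block hρC hη hσ hτ ⟨n, hn⟩ ω ht)
        (h.summable_number hρC hη hfin hσ hτ ω n (by omega)) hμ (z := z)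
        (by rw [hz]; congr 2; push_cast; ring) (e := e) (by rw [he]; congr 1; ring)
      push_cast at this ⊢
      rw [this, mul_assoc (occupation ω ⟨n, hn⟩ : ℂ), Complex.im_ofReal_mul, mul_pow,
        occupation_sq]
      ring
    -- At time `n τ` the atom `n` is just entering, which is the boundary case `n ≤ j` of the
    -- correlation formula.
    rw [Finset.sum_congr rfl fun ω _ => hstep ω, Finset.sum_add_distrib, Finset.sum_sub_distrib,
      ← Finset.mul_sum, ← Finset.mul_sum, ← Finset.mul_sum, ← Complex.im_sum, ← Finset.sum_mul,
      ih (by omega), sum_beamWeight_occupation hη,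
      h.sum_occupation_amplitude hρC hgauge hη hfin hσ hτ hμ hz n ⟨n, hn⟩ le_rfl,
      numberFormula_succ he1]
    have hμ0 : μ ≠ 0 := by
      rintro rfl
      have := congrArg Complex.re hμ
      simp at this
      linarith
    have hμc : (starRingEnd ℂ) μ ≠ 0 := by simpa using hμ0
    have hnorm : ((‖μ‖ ^ 2 : ℝ) : ℂ) = μ * (starRingEnd ℂ) μ := by
      rw [Complex.mul_conj, Complex.normSq_eq_norm_sq]
    have hterm : -(Complex.I * g * excitationProb η ^ 2 / μ) * (1 - z ^ n)
          * ((z - e) / (starRingEnd ℂ) μ)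
        = ((-(g * excitationProb η ^ 2 / ‖μ‖ ^ 2) : ℝ) : ℂ)
          * (Complex.I * ((1 - z ^ n) * (z - e))) := by
      rw [Complex.ofReal_neg, Complex.ofReal_div, hnorm]
      push_cast
      field_simp
    rw [hterm, Complex.im_ofReal_mul, Complex.I_mul_im]
    ring

end IsEvolution

end LeakyCavity
end

/-! ### The photon number in real form and its limit -/

theorem theorem4p3p1 (ε E g σ τ : ℝ) (hσ : 0 < σ) (hτ : 0 < τ)
    (ρC : LeakyCavity.Cavity →L[ℂ] LeakyCavity.Cavity)
    (hρC : LeakyCavity.IsCavityState ρC)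
    (hgauge : LeakyCavity.IsGaugeInvariant ρC)
    (hfin : LeakyCavity.FinitePhotonNumber ρC)
    (η : Matrix (Fin 2) (Fin 2) ℂ) (hη : LeakyCavity.IsAtomState η)
    (p : ℝ) (hp : p = LeakyCavity.excitationProb η)
    (μ : ℂ) (hμ : μ = σ / 2 + Complex.I * ε)
    (ρ : (M : ℕ) → ℝ → LeakyCavity.System M →L[ℂ] LeakyCavity.System M)
    (hρ : ∀ M, LeakyCavity.IsEvolution ε E g σ τ ρC η M (ρ M)) :
    (∀ M n : ℕ, n ≤ M →
      LeakyCavity.FinitePhotonNumber (LeakyCavity.traceAtoms (ρ M (n * τ))) ∧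
      LeakyCavity.photonNumber (LeakyCavity.traceAtoms (ρ M (n * τ))) =
        Real.exp (-n * σ * τ) * LeakyCavity.photonNumber ρC
          + p * (g ^ 2 / ‖μ‖ ^ 2)
              * (1 + Real.exp (-σ * τ) - 2 * Real.exp (-σ * τ / 2) * Real.cos (ε * τ))
              * ((1 - Real.exp (-n * σ * τ)) / (1 - Real.exp (-σ * τ)))
          - p ^ 2 * (2 * g ^ 2 / ‖μ‖ ^ 2)
              * (1 - Real.exp (-σ * τ / 2) * Real.cos (ε * τ))
              * ((1 - Real.exp (-n * σ * τ)) / (1 - Real.exp (-σ * τ)))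
          + p ^ 2 * (2 * g ^ 2 / ‖μ‖ ^ 2)
              * (1 - Real.exp (-n * σ * τ / 2) * Real.cos (n * ε * τ))) ∧
    Tendsto (fun n : ℕ => LeakyCavity.photonNumber (LeakyCavity.traceAtoms (ρ n (n * τ)))) atTop
      (𝓝 (4 * g ^ 2 / (4 * ε ^ 2 + σ ^ 2) * (p / (1 - Real.exp (-σ * τ)))
        * (1 + Real.exp (-σ * τ) * (1 - 2 * p)
            - 2 * Real.exp (-σ * τ / 2) * (1 - p) * Real.cos (ε * τ)))) := by
  have hpow : ∀ n : ℕ, (Complex.exp (-μ * τ) ^ n).re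
      = Real.exp (-n * σ * τ / 2) * Real.cos (n * ε * τ) := by
    intro n
    rw [← Complex.exp_nat_mul, Complex.exp_re, hμ]
    have h1 : ((n : ℂ) * (-(σ / 2 + Complex.I * ε) * τ)).re = -n * σ * τ / 2 := by
      simp [← Complex.ofReal_natCast]; ring
    have h2 : ((n : ℂ) * (-(σ / 2 + Complex.I * ε) * τ)).im = -(n * ε * τ) := by
      simp [← Complex.ofReal_natCast]; ring
    rw [h1, h2, Real.cos_neg]
  have hre : (Complex.exp (-μ * τ)).re = Real.exp (-σ * τ / 2) * Real.cos (ε * τ) := by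
    simpa using hpow 1
  have hexp : ∀ n : ℕ, Real.exp (-σ * τ) ^ n = Real.exp (-n * σ * τ) := by
    intro n
    rw [← Real.exp_nat_mul]
    congr 1
    ring
  have hmain : ∀ M n : ℕ, n ≤ M →
      LeakyCavity.FinitePhotonNumber (LeakyCavity.traceAtoms (ρ M (n * τ))) ∧
      LeakyCavity.photonNumber (LeakyCavity.traceAtoms (ρ M (n * τ)))
        = LeakyCavity.numberFormula (g ^ 2 / ‖μ‖ ^ 2) p (Real.exp (-σ * τ))
          (Complex.exp (-μ * τ)) (LeakyCavity.photonNumber ρC) n := by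
    intro M n hn
    have h1 := LeakyCavity.photonNumber_traceAtoms fun ω =>
      (hρ M).summable_number hρC hη hfin hσ hτ ω n hn
    exact ⟨h1.1, h1.2.trans (hp ▸ (hρ M).sum_modeNumber hρC hgauge hη hfin hσ hτ hμ rfl n hn)⟩
  refine ⟨fun M n hn => ⟨(hmain M n hn).1, ?_⟩, ?_⟩
  · rw [(hmain M n hn).2, LeakyCavity.numberFormula, hpow, hre, hexp]
    ring
  · have he1 : Real.exp (-σ * τ) < 1 := by
      rw [Real.exp_lt_one_iff]
      nlinarith [mul_pos hσ hτ]
    have hz1 : ‖Complex.exp (-μ * τ)‖ < 1 := by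
      rw [Complex.norm_exp, Real.exp_lt_one_iff, hμ]
      simp [hσ, hτ]
    have hlim := LeakyCavity.tendsto_numberFormula (G := g ^ 2 / ‖μ‖ ^ 2) (p := p)
      (N₀ := LeakyCavity.photonNumber ρC) (Real.exp_pos _).le he1 hz1
    have hnorm : ‖μ‖ ^ 2 = (4 * ε ^ 2 + σ ^ 2) / 4 := by
      rw [← Complex.normSq_eq_norm_sq, Complex.normSq_apply, hμ]
      simp
      ring
    rw [hre, hnorm] at hlim
    -- The formula does not depend on `M`, so the sequence with `M = n` needs no compatibility
    -- between the evolutions for different beams.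
    simp_rw [fun n : ℕ => (hmain n n le_rfl).2, hnorm]
    convert hlim using 2
    have : 4 * ε ^ 2 + σ ^ 2 ≠ 0 := by positivity
    have he' : 1 - Real.exp (-σ * τ) ≠ 0 := by linarith
    field_simp
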